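/- Let $N\ge 1$ and let $T$ be a nondegenerate $N$-simplex in $\mathbb{R}^N$ with ordered vertices $v_0,\dots,v_N$; let $C_T\in\mathbb{R}^N$ be any point (the center). For an $N$-simplex $S$ with ordered vertices $u_0,\dots,u_N$ let $\mathrm{Vol}(S)=\frac1{N!}\det[u_1-u_0,\dots,u_N-u_0]$ be its signed volume. *Duality structure.* For a face $\sigma$ of $T$ let $C_\sigma$ be the orthogonal projection of $C_T$ to the affine span of $\sigma$. If $\tau$ is a facet of the face $\sigma$, let $\ell^*(\tau\subset\sigma)=\pm\|C_\sigma-C_\tau\|$, with sign $+$ exactly when $C_\sigma$ lies on the same side of $\tau$ (within the affine span of $\sigma$) as $\sigma$. For a face $\sigma$ of dimension $d$ containing the edge $[i,j]$ put $$\ell^*([i,j]\subset\sigma)=\frac1{(d-1)!}\sum_{[i,j]=\sigma_1\subset\sigma_2\subset\cdots\subset\sigma_d=\sigma}\ \prod_{m=1}^{d-1}\ell^*(\sigma_m\subset\sigma_{m+1}),$$ the sum being over chains of faces with $\dim\sigma_m=m$ (so the value is $1$ for $d=1$). Write $\ell^*_{ij}=\ell^*([i,j]\subset T)$ and $\ell_{ij}=\|v_i-v_j\|$.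 *Laplacian determinant.* Let $L$ be the $(N+1)\times(N+1)$ matrix with $L_{ij}=\ell^*_{ij}/\ell_{ij}$ for $i\ne j$ and with row sums zero, and let $K^*(T)=\det(-\widehat L_{00})$, where $\widehat L_{00}$ is $L$ with its first row and first column removed. *Dual simplex.* Let $n_i=\sum_{j\ne i}\frac{\ell^*_{ij}}{\ell_{ij}}(v_j-v_i)$, and let $\widehat n$ be the matrix with columns $n_1,\dots,n_N$. A dual simplex $T^\#$ is a nondegenerate $N$-simplex in $\mathbb{R}^N$ with ordered vertices such that for every $i=0,\dots,N$ the vector $n_i$ is an outward normal of the facet of $T^\#$ opposite its $i$-th vertex, with length equal to the $(N-1)$-dimensional volume of that facet. Then: 1. $\displaystyle K^*(T)=\frac{(-1)^N\det(\widehat n)}{N!\,\mathrm{Vol}(T)}$. 2. A dual simplex $T^\#$ exists if and only if $K^*(T)\neq0$, and for $N\ge2$ it is unique up to translation. For every dual simplex $T^\#$, $$K^*(T)=\frac{N^N\,\operatorname{sgn}(\mathrm{Vol}(T^\#))\,|\mathrm{Vol}(T^\#)|^{N-1}}{(N!)^2\,\mathrm{Vol}(T)};$$ in particular, if $N$ is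 even or $\mathrm{Vol}(T^\#)>0$, then $$K^*(T)=\frac{N^N\,\mathrm{Vol}(T^\#)^{N-1}}{(N!)^2\,\mathrm{Vol}(T)}.$$ 3. Suppose $N\ge2$. Let $\sigma_{\widehat i}$ be the facet of $T$ opposite $v_i$ and $A_{\widehat i}$ its $(N-1)$-dimensional volume. Let $A$ be the $(N+1)\times(N+1)$ matrix with entries $A_{ii}=0$ and, for $i\ne j$, $$A_{ij}=\frac1{N-1}\sum_{k\ne i,j}\ell([j]\subset[j,k])\;\ell^*([j,k]\subset\sigma_{\widehat i}),\qquad \ell([j]\subset[j,k])=\frac{(C_{[j,k]}-v_j)\cdot(v_k-v_j)}{\|v_k-v_j\|},$$ the signed volume of the part of the facet $\sigma_{\widehat i}$ that is assigned to the vertex $j$. Then $$K^*(T)=\frac{(-1)^N N^N\,|\mathrm{Vol}(T)|^{N-2}\det(A)}{(N!)^2\prod_{i=0}^N A_{\widehat i}}.$$ -/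

import Mathlib

open scoped Nat

namespace SimplexDuality

/-- `E N` is Euclidean space `ℝ^N`. -/
abbrev E (N : ℕ) := EuclideanSpace ℝ (Fin N)

noncomputable section

/-! ### Volumes -/

/-- The signed volume `det [v₁ - v₀, …, v_N - v₀] / N!` of a full-dimensional simplex with
ordered vertices. -/
def signedVolume {N : ℕ} (T : Affine.Simplex ℝ (E N) N) : ℝ :=
  (Matrix.of fun a j : Fin N => (T.points j.succ - T.points 0) a).det / N !

/-- The (unsigned) `k`-dimensional volume of a `k`-simplex in `ℝ^N`, through the Gram determinant
of its edge vectors at the first vertex. -/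
def simplexVolume {N k : ℕ} (s : Affine.Simplex ℝ (E N) k) : ℝ :=
  √(Matrix.gram ℝ fun a : Fin k => s.points a.succ - s.points 0).det / k !

/-- The vectors `n i` are the outward normals of the facets of `S` (the `i`-th facet being the one
opposite the vertex `i`), with lengths equal to the `(N-1)`-dimensional volumes of the facets. -/
structure AreFaceNormals {N : ℕ} [NeZero N] (S : Affine.Simplex ℝ (E N) N)
    (n : Fin (N + 1) → E N) : Prop where
  orthogonal : ∀ i j k, j ≠ i → k ≠ i → inner ℝ (n i) (S.points j - S.points k) = 0
  outward : ∀ i j, j ≠ i → inner ℝ (n i) (S.points i - S.points j) < 0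
  norm_eq : ∀ i, ‖n i‖ = simplexVolume (S.faceOpposite i)

/-! ### The duality structure of a simplex with a chosen center

Faces of `T` are given by their nonempty sets of vertices. -/

variable {N : ℕ} (T : Affine.Simplex ℝ (E N) N) (C : E N)

/-- The affine span of the face `σ`. -/
def faceSpan (σ : Finset (Fin (N + 1))) : AffineSubspace ℝ (E N) :=
  affineSpan ℝ (T.points '' (σ : Set (Fin (N + 1))))

theorem faceSpan_nonempty {σ : Finset (Fin (N + 1))} (h : σ.Nonempty) :
    Nonempty (faceSpan T σ) := by
  obtain ⟨k, hk⟩ := h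
  exact ⟨⟨T.points k, subset_affineSpan ℝ _ ⟨k, hk, rfl⟩⟩⟩

/-- The center of the face `σ`: the orthogonal projection of `C` to the affine span of `σ`
(the empty set of vertices is not a face, its value is irrelevant). -/
def faceCenter (σ : Finset (Fin (N + 1))) : E N :=
  open Classical in
  if h : σ.Nonempty then
    haveI := faceSpan_nonempty T h
    (EuclideanGeometry.orthogonalProjection (faceSpan T σ) C : E N)
  else C

/-- The signed dual length `ℓ*(τ ⊂ σ)` for a facet `τ` of the face `σ`: the distance of the two
centers, with the positive sign when the center of `σ` is on the same side of `τ` as `σ`,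
that is, as the vertex of `σ` that is not in `τ`. -/
def dualLength (τ σ : Finset (Fin (N + 1))) : ℝ :=
  open Classical in
  if ∃ k ∈ σ \ τ, (faceSpan T τ).SSameSide (faceCenter T C σ) (T.points k) then
    dist (faceCenter T C σ) (faceCenter T C τ)
  else -dist (faceCenter T C σ) (faceCenter T C τ)

/-- The maximal chains `τ = c 0 ⊂ c 1 ⊂ ⋯ ⊂ c (#σ - #τ) = σ` of faces between `τ` and `σ`
(each step adds exactly one vertex). -/
def chains (τ σ : Finset (Fin (N + 1))) :
    Finset (Fin (σ.card - τ.card + 1) → Finset (Fin (N + 1))) :=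
  open Classical in
  Finset.univ.filter fun c => StrictMono c ∧ c 0 = τ ∧ c (Fin.last _) = σ

/-- The signed volume of the dual cell of the face `τ` in the face `σ ⊇ τ`. -/
def dualVolume (τ σ : Finset (Fin (N + 1))) : ℝ :=
  (∑ c ∈ chains τ σ, ∏ m : Fin (σ.card - τ.card), dualLength T C (c m.castSucc) (c m.succ)) /
    (σ.card - τ.card)!

/-- The signed length of the part of the edge `[j, k]` that belongs to `j`: the position of the
center of `[j, k]` on the line from `v_j` to `v_k`. -/
def vertexEdgeLength (j k : Fin (N + 1)) : ℝ :=
  inner ℝ (faceCenter T C {j, k} - T.points j) (T.points k - T.points j) /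
    dist (T.points j) (T.points k)

/-- The signed `(N-1)`-dimensional volume of the part of the facet opposite `i` that belongs to
the vertex `j`. -/
def vertexFacetVolume (i j : Fin (N + 1)) : ℝ :=
  if i = j then 0 else
    (∑ k ∈ Finset.univ.filter (fun k => k ≠ i ∧ k ≠ j),
      vertexEdgeLength T C j k * dualVolume T C {j, k} (Finset.univ.erase i)) / ((N : ℝ) - 1)

/-- The matrix with entry `vertexFacetVolume i j` in row `i` and column `j`. -/
def vertexFacetMatrix : Matrix (Fin (N + 1)) (Fin (N + 1)) ℝ :=
  Matrix.of fun i j => vertexFacetVolume T C i j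

/-- The weight `ℓ*_ij / ℓ_ij` of the edge `[i, j]`. -/
def edgeWeight (i j : Fin (N + 1)) : ℝ :=
  dualVolume T C {i, j} Finset.univ / dist (T.points i) (T.points j)

/-- The vector `n_i = ∑_{j ≠ i} (ℓ*_ij / ℓ_ij) (v_j - v_i)`. -/
def vertexNormal (i : Fin (N + 1)) : E N :=
  ∑ j ∈ Finset.univ.erase i, edgeWeight T C i j • (T.points j - T.points i)

/-- The `N × N` matrix with columns `n_1, …, n_N`. -/
def normalMatrix : Matrix (Fin N) (Fin N) ℝ :=
  Matrix.of fun a j => vertexNormal T C j.succ a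

/-! ### The Laplacian determinant -/

/-- The matrix of the weighted graph Laplacian `(L f)_i = ∑_{j ≠ i} w_ij (f_j - f_i)` of the
complete graph on the vertices `0, …, N`. -/
def laplacian (w : Fin (N + 1) → Fin (N + 1) → ℝ) : Matrix (Fin (N + 1)) (Fin (N + 1)) ℝ :=
  Matrix.of fun i j => if i = j then -∑ k ∈ Finset.univ.erase i, w i k else w i j

/-- The Laplacian determinant: the determinant of `-L` with the first row and column removed,
for the edge weights of the duality structure. -/
def laplacianDet : ℝ :=
  (-(laplacian (edgeWeight T C)).submatrix Fin.succ Fin.succ).det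

end

end SimplexDuality

/-!
Write `C_σ` for the center of the face `σ`, and for a facet `τ` of `σ = τ ∪ {k}` let `u(τ, k)` be
the unit vector normal to `τ` in the affine span of `σ` that points towards the vertex `k`. The
signed dual length is then the linear quantity `ℓ*(τ ⊂ σ) = ⟪u(τ, k), C - x⟫` for any `x` in the
span of `τ` (`dualLength_insert`), and no signs have to be followed any more.

The geometric heart is that the boundary of the dual cell of a face `τ` in a face `σ` is closed
(`sum_chainSum_smul_unitNormal`): summing over the maximal chains from `τ` to `σ`, the product of
all dual lengths but the first, times the normal of the first step, gives the same vector as the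
product of all dual lengths but the last, times the normal of the last step. The normal is moved
through the chain one step at a time. For a single exchange one sums over the two faces between two
given ones, and the identity is one in a plane (`exchange_steps`). Applied to a vertex `i` of `T`,
this says `n_i = ∑_k A_ki u_k` with `u_k` the inward unit normal of the facet opposite `k`
(`vertexNormal_eq_sum_vertexFacetVolume`). The inner product with `C - v_i` gives the recursion on
the first step of a chain (`chainSum_eq_sum_insert`), which identifies the entries `A_ki` as sums
over chains.

Volumes enter through the sum over the vertices `j` of a face `σ` of the signed volumes of the cells
of `j` in `σ`. It satisfies "volume is base times height over the dimension" for every facet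
(`cellSum_insert`), because the heights over a common face commute (`norm_heightVector_mul_comm`)
and the barycentric coordinates of `C_σ` sum to one. Gram determinants obey the same recursion by
Cramer's rule (`det_gram_eq_norm_sq_mul`), so the cells of the vertices fill up the face
(`sqrt_det_gram_eq_cellSum`). As a by-product, facet volume times height is `N |Vol|`.

The rest is linear algebra.
* The formula through the normal matrix is the factorization of that matrix into the edge matrix of
  `T` and the reduced Laplacian (`normalMatrix_eq_mul`).
* For vectors `n_i` with sum zero, a simplex `S` has facet normals `n_i` exactly when
  `⟪n_i, S_j - S_0⟫ = -N |Vol S| δ_ij` for `i, j ≥ 1` (`areFaceNormals_iff_transpose_mul`).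
  Determinants give the formula through `Vol S`. The volume, and with it the edge matrix of `S`, is
  determined by the normals if `N ≥ 2`. A simplex is constructed by scaling the dual basis of the
  normals; for `N = 1` no scaling is needed because the `n_i` are unit vectors.
* Since `⟪u_k, v_j - v_m⟫ = h_k (δ_kj - δ_km)` with the height `h_k = N |Vol T| / A_k̂`, the pairing
  of `n_i` with `v_j - v_0` is `h_j A_ji - h_0 A_0i`. The matrix of the `h_k A_ki` has constant row
  sums `N |Vol T|`, so these differences carry its determinant
  (`det_eq_mul_det_sub_of_row_sum`, `det_normalMatrix_mul_eq_det_vertexFacetMatrix`).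
-/

namespace SimplexDuality

noncomputable section

/-! ### Centers, heights and unit normals of faces -/

section FaceGeometry

variable {N : ℕ} (T : Affine.Simplex ℝ (E N) N) (C : E N)

theorem points_mem_faceSpan {σ : Finset (Fin (N + 1))} {i : Fin (N + 1)} (hi : i ∈ σ) :
    T.points i ∈ faceSpan T σ :=
  subset_affineSpan ℝ _ ⟨i, hi, rfl⟩

theorem points_notMem_faceSpan {σ : Finset (Fin (N + 1))} {k : Fin (N + 1)} (hk : k ∉ σ) :
    T.points k ∉ faceSpan T σ := by
  rw [faceSpan, T.independent.mem_affineSpan_iff]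
  exact hk

theorem faceSpan_mono {τ σ : Finset (Fin (N + 1))} (h : τ ⊆ σ) : faceSpan T τ ≤ faceSpan T σ :=
  affineSpan_mono ℝ (Set.image_mono (by exact_mod_cast h))

theorem points_sub_mem_direction {σ : Finset (Fin (N + 1))} {i j : Fin (N + 1)} (hi : i ∈ σ)
    (hj : j ∈ σ) : T.points i - T.points j ∈ (faceSpan T σ).direction :=
  AffineSubspace.vsub_mem_direction (points_mem_faceSpan T hi) (points_mem_faceSpan T hj)

theorem faceSpan_univ : faceSpan T Finset.univ = ⊤ := by
  have h := T.independent.affineSpan_eq_top_iff_card_eq_finrank_add_one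
  simp only [Fintype.card_fin, finrank_euclideanSpace] at h
  simpa [faceSpan] using h

theorem faceCenter_mem {σ : Finset (Fin (N + 1))} (hσ : σ.Nonempty) :
    faceCenter T C σ ∈ faceSpan T σ := by
  have := faceSpan_nonempty T hσ
  rw [faceCenter, dif_pos hσ]
  exact EuclideanGeometry.orthogonalProjection_mem _

theorem inner_sub_faceCenter {σ : Finset (Fin (N + 1))} (hσ : σ.Nonempty) {v : E N}
    (hv : v ∈ (faceSpan T σ).direction) : inner ℝ (C - faceCenter T C σ) v = 0 := by
  have := faceSpan_nonempty T hσ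
  rw [faceCenter, dif_pos hσ]
  exact Submodule.inner_left_of_mem_orthogonal hv
    (EuclideanGeometry.vsub_orthogonalProjection_mem_direction_orthogonal _ _)

theorem faceCenter_eq_of_mem {σ : Finset (Fin (N + 1))} (hσ : σ.Nonempty) {y : E N}
    (hy : y ∈ faceSpan T σ) (h : ∀ v ∈ (faceSpan T σ).direction, inner ℝ (C - y) v = 0) :
    faceCenter T C σ = y := by
  have hd : faceCenter T C σ - y ∈ (faceSpan T σ).direction :=
    AffineSubspace.vsub_mem_direction (faceCenter_mem T C hσ) hy
  have h1 := h _ hd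
  have h2 := inner_sub_faceCenter T C hσ hd
  have h3 : inner ℝ (faceCenter T C σ - y) (faceCenter T C σ - y) = 0 := by
    have : faceCenter T C σ - y = (C - y) - (C - faceCenter T C σ) := by abel
    conv_lhs => rw [this, inner_sub_left, ← this, h1, h2, sub_zero]
  exact sub_eq_zero.1 (inner_self_eq_zero.1 h3)

/-- The vector from the foot of the perpendicular dropped from the vertex `k` on the face `τ`
to the vertex `k`. -/
def heightVector (τ : Finset (Fin (N + 1))) (k : Fin (N + 1)) : E N :=
  T.points k - faceCenter T (T.points k) τ

/-- The unit vector normal to the face `τ` inside the face spanned by `τ` and the vertex `k`,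
pointing towards `k`; this is meaningful for nonempty
`τ` not containing `k`, and zero if the height vanishes. -/
def unitNormal (τ : Finset (Fin (N + 1))) (k : Fin (N + 1)) : E N :=
  ‖heightVector T τ k‖⁻¹ • heightVector T τ k

variable {τ : Finset (Fin (N + 1))} {k : Fin (N + 1)}

theorem heightVector_ne_zero (hτ : τ.Nonempty) (hk : k ∉ τ) : heightVector T τ k ≠ 0 := by
  intro h
  apply points_notMem_faceSpan T hk
  rw [sub_eq_zero.1 h]
  exact faceCenter_mem T _ hτ

theorem norm_heightVector_pos (hτ : τ.Nonempty) (hk : k ∉ τ) : 0 < ‖heightVector T τ k‖ :=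
  norm_pos_iff.2 (heightVector_ne_zero T hτ hk)

theorem norm_unitNormal (hτ : τ.Nonempty) (hk : k ∉ τ) : ‖unitNormal T τ k‖ = 1 :=
  norm_smul_inv_norm (heightVector_ne_zero T hτ hk)

theorem norm_smul_unitNormal (hτ : τ.Nonempty) (hk : k ∉ τ) :
    ‖heightVector T τ k‖ • unitNormal T τ k = heightVector T τ k := by
  rw [unitNormal, smul_smul, mul_inv_cancel₀ (norm_heightVector_pos T hτ hk).ne', one_smul]

theorem inner_heightVector_of_mem (hτ : τ.Nonempty) {v : E N}
    (hv : v ∈ (faceSpan T τ).direction) : inner ℝ (heightVector T τ k) v = 0 :=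
  inner_sub_faceCenter T _ hτ hv

theorem inner_unitNormal_of_mem (hτ : τ.Nonempty) {v : E N}
    (hv : v ∈ (faceSpan T τ).direction) : inner ℝ (unitNormal T τ k) v = 0 := by
  rw [unitNormal, real_inner_smul_left, inner_heightVector_of_mem T hτ hv, mul_zero]

theorem heightVector_mem_direction (hτ : τ.Nonempty) :
    heightVector T τ k ∈ (faceSpan T (insert k τ)).direction :=
  AffineSubspace.vsub_mem_direction (points_mem_faceSpan T (Finset.mem_insert_self _ _))
    (faceSpan_mono T (Finset.subset_insert _ _) (faceCenter_mem T _ hτ))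

theorem unitNormal_mem_direction (hτ : τ.Nonempty) :
    unitNormal T τ k ∈ (faceSpan T (insert k τ)).direction :=
  Submodule.smul_mem _ _ (heightVector_mem_direction T hτ)

/-- The direction of a face is that of a facet together with the height on that facet. -/
theorem exists_eq_smul_heightVector_add (hτ : τ.Nonempty) {w : E N}
    (hw : w ∈ (faceSpan T (insert k τ)).direction) :
    ∃ c : ℝ, ∃ d ∈ (faceSpan T τ).direction, w = c • heightVector T τ k + d := by
  have h : faceSpan T (insert k τ) =
      affineSpan ℝ (insert (T.points k) (faceSpan T τ : Set (E N))) := by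
    rw [faceSpan, faceSpan, affineSpan_insert_affineSpan, Finset.coe_insert, Set.image_insert_eq]
  rw [h, AffineSubspace.direction_affineSpan_insert (faceCenter_mem T (T.points k) hτ),
    Submodule.mem_sup] at hw
  obtain ⟨a, ha, d, hd, rfl⟩ := hw
  obtain ⟨c, rfl⟩ := Submodule.mem_span_singleton.1 ha
  exact ⟨c, d, hd, rfl⟩

theorem eq_smul_unitNormal (hτ : τ.Nonempty) (hk : k ∉ τ) {w : E N}
    (hw : w ∈ (faceSpan T (insert k τ)).direction)
    (h : ∀ v ∈ (faceSpan T τ).direction, inner ℝ w v = 0) :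
    w = inner ℝ w (unitNormal T τ k) • unitNormal T τ k := by
  obtain ⟨c, d, hd, rfl⟩ := exists_eq_smul_heightVector_add T hτ hw
  have h1 := h d hd
  rw [inner_add_left, real_inner_smul_left, inner_heightVector_of_mem T hτ hd, mul_zero,
    zero_add, inner_self_eq_zero] at h1
  subst h1
  have h2 : inner ℝ (unitNormal T τ k) (unitNormal T τ k) = (1 : ℝ) := by
    rw [real_inner_self_eq_norm_sq, norm_unitNormal T hτ hk, one_pow]
  rw [add_zero, ← norm_smul_unitNormal T hτ hk, real_inner_smul_left, real_inner_smul_left, h2,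
    mul_one, smul_smul]

theorem inner_unitNormal_points_sub (hτ : τ.Nonempty) (hk : k ∉ τ) {x : E N}
    (hx : x ∈ faceSpan T τ) :
    inner ℝ (unitNormal T τ k) (T.points k - x) = ‖heightVector T τ k‖ := by
  have h0 : T.points k - x = heightVector T τ k + (faceCenter T (T.points k) τ - x) := by
    rw [heightVector]; abel
  have h1 := inner_unitNormal_of_mem T hτ (k := k)
    (AffineSubspace.vsub_mem_direction (faceCenter_mem T (T.points k) hτ) hx)
  rw [vsub_eq_sub] at h1
  rw [h0, inner_add_right, h1, add_zero, unitNormal, real_inner_smul_left,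
    real_inner_self_eq_norm_sq]
  have := (norm_heightVector_pos T hτ hk).ne'
  field_simp

/-- The centers of a face and of one of its facets differ by a multiple of the unit normal. -/
theorem faceCenter_insert_sub (hτ : τ.Nonempty) (hk : k ∉ τ) {x : E N} (hx : x ∈ faceSpan T τ) :
    faceCenter T C (insert k τ) - faceCenter T C τ =
      inner ℝ (unitNormal T τ k) (C - x) • unitNormal T τ k := by
  have hσ : (insert k τ).Nonempty := Finset.insert_nonempty _ _
  have hle := faceSpan_mono T (Finset.subset_insert k τ)
  rw [eq_smul_unitNormal T hτ hk (w := faceCenter T C (insert k τ) - faceCenter T C τ)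
    (AffineSubspace.vsub_mem_direction (faceCenter_mem T C hσ) (hle (faceCenter_mem T C hτ)))]
  · congr 1
    have h1 := inner_sub_faceCenter T C hσ (unitNormal_mem_direction T hτ (k := k))
    have h2 := inner_unitNormal_of_mem T hτ (k := k)
      (AffineSubspace.vsub_mem_direction (faceCenter_mem T C hτ) hx)
    rw [vsub_eq_sub] at h2
    rw [real_inner_comm, inner_sub_right] at h1
    rw [inner_sub_right] at h2
    rw [real_inner_comm, inner_sub_right, inner_sub_right]
    linarith
  · intro v hv
    have h1 := inner_sub_faceCenter T C hσ (AffineSubspace.direction_le hle hv)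
    have h2 := inner_sub_faceCenter T C hτ hv
    rw [inner_sub_left] at h1 h2 ⊢
    linarith

/-- The signed dual length is a linear coordinate of the center. This form carries no case
distinction, and every later identity rests on it. -/
theorem dualLength_insert (hτ : τ.Nonempty) (hk : k ∉ τ) {x : E N} (hx : x ∈ faceSpan T τ) :
    dualLength T C τ (insert k τ) = inner ℝ (unitNormal T τ k) (C - x) := by
  classical
  set c := inner ℝ (unitNormal T τ k) (C - x) with hc
  have hsub := faceCenter_insert_sub T C hτ hk hx
  rw [← hc] at hsub
  have hdist : dist (faceCenter T C (insert k τ)) (faceCenter T C τ) = |c| := by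
    rw [dist_eq_norm, hsub, norm_smul, norm_unitNormal T hτ hk, mul_one, Real.norm_eq_abs]
  have hsdiff : insert k τ \ τ = {k} := by
    rw [Finset.insert_sdiff_of_notMem _ hk, sdiff_self]; rfl
  have hu : inner ℝ (unitNormal T τ k) (unitNormal T τ k) = (1 : ℝ) := by
    rw [real_inner_self_eq_norm_sq, norm_unitNormal T hτ hk, one_pow]
  have hside : (∃ m ∈ insert k τ \ τ, (faceSpan T τ).SSameSide (faceCenter T C (insert k τ))
      (T.points m)) ↔ 0 < c := by
    rw [hsdiff]
    simp only [Finset.mem_singleton, exists_eq_left]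
    rw [AffineSubspace.sSameSide_iff_exists_left (faceCenter_mem T C hτ)]
    constructor
    · rintro ⟨hx', -, p, hp, hray⟩
      rw [vsub_eq_sub, vsub_eq_sub, hsub] at hray
      have hip := inner_unitNormal_points_sub T hτ hk hp
      have hpos := norm_heightVector_pos T hτ hk
      rcases hray with h | h | ⟨r₁, r₂, h₁, h₂, h⟩
      · rw [h] at hsub
        exact absurd (sub_eq_zero.1 hsub ▸ faceCenter_mem T C hτ) hx'
      · rw [h, inner_zero_right] at hip
        exact absurd hip hpos.ne
      · have h' := congrArg (inner ℝ (unitNormal T τ k)) h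
        rw [real_inner_smul_right, real_inner_smul_right, real_inner_smul_right, hu, mul_one,
          hip] at h'
        exact pos_of_mul_pos_right (h' ▸ mul_pos h₂ hpos) h₁.le
    · intro hpos
      refine ⟨fun hmem => ?_, points_notMem_faceSpan T hk, faceCenter T (T.points k) τ,
        faceCenter_mem T _ hτ, ?_⟩
      · have h := inner_unitNormal_of_mem T hτ (k := k)
          (AffineSubspace.vsub_mem_direction hmem (faceCenter_mem T C hτ))
        rw [vsub_eq_sub, hsub, real_inner_smul_right, hu, mul_one] at h
        exact hpos.ne' h
      · rw [vsub_eq_sub, vsub_eq_sub, hsub]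
        change SameRay ℝ _ (heightVector T τ k)
        rw [← norm_smul_unitNormal T hτ hk]
        exact (SameRay.sameRay_nonneg_smul_left _ hpos.le).nonneg_smul_right (norm_nonneg _)
  rw [dualLength]
  split_ifs with h
  · rw [hdist, abs_of_pos (hside.1 h)]
  · rw [hdist, abs_of_nonpos (not_lt.1 fun h' => h (hside.2 h')), neg_neg]

/-- One Gram–Schmidt step: the height of `b` over the face `insert a τ`. -/
theorem heightVector_insert {a b : Fin (N + 1)} (hτ : τ.Nonempty) (ha : a ∉ τ) :
    heightVector T (insert a τ) b = heightVector T τ b -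
      inner ℝ (unitNormal T τ a) (heightVector T τ b) • unitNormal T τ a := by
  set u := unitNormal T τ a with hu
  have huu : inner ℝ u u = (1 : ℝ) := by
    rw [real_inner_self_eq_norm_sq, norm_unitNormal T hτ ha, one_pow]
  rw [heightVector, faceCenter_eq_of_mem T _ (Finset.insert_nonempty a τ)
    (y := inner ℝ u (heightVector T τ b) • u + faceCenter T (T.points b) τ)]
  · rw [heightVector]; abel
  · exact AffineSubspace.vadd_mem_of_mem_direction
      (Submodule.smul_mem _ _ (unitNormal_mem_direction T hτ))
      (faceSpan_mono T (Finset.subset_insert _ _) (faceCenter_mem T _ hτ))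
  · intro v hv
    obtain ⟨c, d, hd, rfl⟩ := exists_eq_smul_heightVector_add T hτ hv
    have h0 : T.points b - (inner ℝ u (heightVector T τ b) • u + faceCenter T (T.points b) τ) =
        heightVector T τ b - inner ℝ u (heightVector T τ b) • u := by
      rw [heightVector]; abel
    rw [h0, ← norm_smul_unitNormal T hτ ha, ← hu, inner_sub_left, inner_add_right, inner_add_right,
      inner_heightVector_of_mem T hτ hd, real_inner_smul_left, real_inner_smul_left,
      inner_unitNormal_of_mem T hτ hd, real_inner_smul_right, real_inner_smul_right,
      real_inner_smul_right, real_inner_smul_right, huu, real_inner_comm u]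
    ring

theorem heightVector_insert_eq_smul {a b : Fin (N + 1)} (hτ : τ.Nonempty) (ha : a ∉ τ)
    (hb : b ∉ τ) :
    heightVector T (insert a τ) b = ‖heightVector T τ b‖ • (unitNormal T τ b -
      inner ℝ (unitNormal T τ a) (unitNormal T τ b) • unitNormal T τ a) := by
  rw [heightVector_insert T hτ ha]
  conv_lhs => rw [← norm_smul_unitNormal T hτ hb]
  rw [real_inner_smul_right, smul_sub, smul_smul]

theorem norm_sub_inner_smul {u v : E N} (hu : ‖u‖ = 1) (hv : ‖v‖ = 1) :
    ‖v - inner ℝ u v • u‖ = √(1 - inner ℝ u v ^ 2) := by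
  rw [← Real.sqrt_sq (norm_nonneg (v - _)), norm_sub_sq_real, real_inner_smul_right, norm_smul,
    hu, hv, real_inner_comm u v, mul_one, Real.norm_eq_abs, sq_abs]
  congr 1
  ring

/-- The area of the parallelogram spanned by two heights over a common face, computed from both
sides. -/
theorem norm_heightVector_mul_comm {a b : Fin (N + 1)} (hτ : τ.Nonempty) (ha : a ∉ τ)
    (hb : b ∉ τ) :
    ‖heightVector T τ a‖ * ‖heightVector T (insert a τ) b‖ =
      ‖heightVector T τ b‖ * ‖heightVector T (insert b τ) a‖ := by
  rw [heightVector_insert_eq_smul T hτ ha hb, heightVector_insert_eq_smul T hτ hb ha, norm_smul,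
    norm_smul, norm_sub_inner_smul (norm_unitNormal T hτ ha) (norm_unitNormal T hτ hb),
    norm_sub_inner_smul (norm_unitNormal T hτ hb) (norm_unitNormal T hτ ha), norm_norm, norm_norm,
    real_inner_comm]
  ring

theorem unitNormal_insert {a b : Fin (N + 1)} (hτ : τ.Nonempty) (ha : a ∉ τ) (hb : b ∉ τ) :
    unitNormal T (insert a τ) b =
      (√(1 - inner ℝ (unitNormal T τ a) (unitNormal T τ b) ^ 2))⁻¹ • (unitNormal T τ b -
        inner ℝ (unitNormal T τ a) (unitNormal T τ b) • unitNormal T τ a) := by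
  have h := (norm_heightVector_pos T hτ hb).ne'
  rw [unitNormal, heightVector_insert_eq_smul T hτ ha hb, norm_smul, norm_norm,
    norm_sub_inner_smul (norm_unitNormal T hτ ha) (norm_unitNormal T hτ hb), smul_smul, mul_inv,
    mul_right_comm, inv_mul_cancel₀ h, one_mul]

/-- Exchange of two consecutive steps. For either order of `a` and `b`, the difference of the two
summands is a quarter turn of the center relative to `τ`, in the plane normal to `τ` inside the face
spanned by `τ`, `a`, `b`; the two orders turn in opposite directions, so that the differences
cancel. -/
theorem exchange_steps {a b : Fin (N + 1)} (hτ : τ.Nonempty) (ha : a ∉ τ) (hb : b ∉ τ)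
    (hab : a ≠ b) :
    dualLength T C (insert a τ) (insert b (insert a τ)) • unitNormal T τ a +
        dualLength T C (insert b τ) (insert a (insert b τ)) • unitNormal T τ b =
      dualLength T C τ (insert a τ) • unitNormal T (insert a τ) b +
        dualLength T C τ (insert b τ) • unitNormal T (insert b τ) a := by
  obtain ⟨i, hi⟩ := hτ
  have hτ : τ.Nonempty := ⟨i, hi⟩
  have hx := points_mem_faceSpan T hi
  have hb' : b ∉ insert a τ := by simp [hab.symm, hb]
  have ha' : a ∉ insert b τ := by simp [hab, ha]
  rw [dualLength_insert T C hτ ha hx, dualLength_insert T C hτ hb hx,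
    dualLength_insert T C (Finset.insert_nonempty _ _) hb'
      (faceSpan_mono T (Finset.subset_insert a τ) hx),
    dualLength_insert T C (Finset.insert_nonempty _ _) ha'
      (faceSpan_mono T (Finset.subset_insert b τ) hx),
    unitNormal_insert T hτ ha hb, unitNormal_insert T hτ hb ha,
    real_inner_comm (unitNormal T τ a)]
  simp only [real_inner_smul_left, inner_sub_left]
  module

end FaceGeometry

/-! ### Sums over chains of faces -/

section Chains

variable {N : ℕ} (T : Affine.Simplex ℝ (E N) N) (C : E N)

/-- The strictly increasing chains of `n + 1` faces from `τ` to `σ`. -/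
def chainsOfLength (n : ℕ) (τ σ : Finset (Fin (N + 1))) :
    Finset (Fin (n + 1) → Finset (Fin (N + 1))) :=
  open Classical in
  Finset.univ.filter fun c => StrictMono c ∧ c 0 = τ ∧ c (Fin.last _) = σ

/-- The sum over the chains of length `n` from `τ` to `σ` of the products of dual lengths. -/
def chainSumOfLength (n : ℕ) (τ σ : Finset (Fin (N + 1))) : ℝ :=
  ∑ c ∈ chainsOfLength n τ σ, ∏ m : Fin n, dualLength T C (c m.castSucc) (c m.succ)

/-- The sum over all maximal chains from `τ` to `σ` of the products of dual lengths: the signed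
volume of the dual cell of `τ` in `σ` without its factorial. -/
def chainSum (τ σ : Finset (Fin (N + 1))) : ℝ :=
  chainSumOfLength T C (σ.card - τ.card) τ σ

theorem dualVolume_eq_chainSum_div (τ σ : Finset (Fin (N + 1))) :
    dualVolume T C τ σ = chainSum T C τ σ / (σ.card - τ.card)! := rfl

theorem mem_chainsOfLength {n : ℕ} {τ σ : Finset (Fin (N + 1))}
    {c : Fin (n + 1) → Finset (Fin (N + 1))} :
    c ∈ chainsOfLength n τ σ ↔ StrictMono c ∧ c 0 = τ ∧ c (Fin.last _) = σ := by
  simp [chainsOfLength]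

theorem card_add_le_of_mem_chainsOfLength {n : ℕ} {τ σ : Finset (Fin (N + 1))}
    {c : Fin (n + 1) → Finset (Fin (N + 1))} (hc : c ∈ chainsOfLength n τ σ) :
    τ.card + n ≤ σ.card := by
  obtain ⟨hm, rfl, rfl⟩ := mem_chainsOfLength.1 hc
  have h : ∀ m : Fin (n + 1), (c 0).card + m ≤ (c m).card := by
    intro m
    induction m using Fin.induction with
    | zero => simp
    | succ i ih =>
      have := Finset.card_lt_card (hm (Fin.castSucc_lt_succ (i := i)))
      simp only [Fin.val_castSucc, Fin.val_succ] at ih ⊢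
      omega
  simpa using h (Fin.last n)

theorem subset_of_mem_chainsOfLength {n : ℕ} {τ σ : Finset (Fin (N + 1))}
    {c : Fin (n + 1) → Finset (Fin (N + 1))} (hc : c ∈ chainsOfLength n τ σ) : τ ⊆ σ := by
  obtain ⟨hm, rfl, rfl⟩ := mem_chainsOfLength.1 hc
  exact hm.monotone (Fin.zero_le _)

theorem chainSum_self (τ : Finset (Fin (N + 1))) : chainSum T C τ τ = 1 := by
  have h : ∀ n, n = 0 → chainSumOfLength T C n τ τ = 1 := by
    rintro n rfl
    have hc : chainsOfLength 0 τ τ = {fun _ => τ} := by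
      ext c
      rw [mem_chainsOfLength, Finset.mem_singleton]
      constructor
      · rintro ⟨-, h, -⟩
        funext i
        rw [show i = 0 from Subsingleton.elim (α := Fin 1) i 0, h]
      · rintro rfl
        exact ⟨Subsingleton.strictMono (α := Fin 1) _, rfl, rfl⟩
    simp [chainSumOfLength, hc]
  exact h _ (Nat.sub_self _)

theorem strictMono_snoc {n : ℕ} {σ : Finset (Fin (N + 1))} {c : Fin (n + 1) → Finset (Fin (N + 1))}
    (hc : StrictMono c) (h : c (Fin.last n) < σ) :
    StrictMono (Fin.snoc c σ : Fin (n + 2) → Finset (Fin (N + 1))) := by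
  rw [Fin.strictMono_iff_lt_succ]
  intro i
  induction i using Fin.lastCases with
  | last => simpa [Fin.succ_last] using h
  | cast i =>
    rw [Fin.succ_castSucc, Fin.snoc_castSucc, Fin.snoc_castSucc]
    exact hc Fin.castSucc_lt_succ

theorem chainSumOfLength_succ (n : ℕ) (τ σ : Finset (Fin (N + 1))) :
    chainSumOfLength T C (n + 1) τ σ =
      ∑ ρ ∈ σ.ssubsets, chainSumOfLength T C n τ ρ * dualLength T C ρ σ := by
  simp only [chainSumOfLength, Finset.sum_mul]
  rw [Finset.sum_sigma']
  refine Finset.sum_bij' (fun c _ => ⟨c (Fin.last n).castSucc, fun m => c m.castSucc⟩)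
    (fun p _ => (Fin.snoc p.2 σ : Fin (n + 2) → Finset (Fin (N + 1)))) ?_ ?_ ?_ ?_ ?_
  · intro c hc
    obtain ⟨hm, h0, hl⟩ := mem_chainsOfLength.1 hc
    rw [Finset.mem_sigma, Finset.mem_ssubsets, mem_chainsOfLength]
    refine ⟨?_, hm.comp (Fin.strictMono_castSucc), h0, rfl⟩
    rw [← hl]
    exact hm (Fin.castSucc_lt_last _)
  · rintro ⟨ρ, c⟩ hp
    rw [Finset.mem_sigma, Finset.mem_ssubsets, mem_chainsOfLength] at hp
    obtain ⟨hρ, hm, h0, hl⟩ := hp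
    rw [mem_chainsOfLength]
    refine ⟨strictMono_snoc hm (hl ▸ hρ), ?_, Fin.snoc_last _ _⟩
    rw [← Fin.castSucc_zero, Fin.snoc_castSucc]
    exact h0
  · intro c hc
    obtain ⟨hm, h0, hl⟩ := mem_chainsOfLength.1 hc
    funext i
    induction i using Fin.lastCases with
    | last => rw [Fin.snoc_last, hl]
    | cast i => rw [Fin.snoc_castSucc]
  · rintro ⟨ρ, c⟩ hp
    rw [Finset.mem_sigma, Finset.mem_ssubsets, mem_chainsOfLength] at hp
    obtain ⟨hρ, hm, h0, hl⟩ := hp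
    simp only [Fin.snoc_castSucc] at hl ⊢
    subst hl
    rfl
  · intro c hc
    obtain ⟨hm, h0, hl⟩ := mem_chainsOfLength.1 hc
    rw [Fin.prod_univ_castSucc, Fin.succ_last, hl]
    rfl

/-- Recursion on the last step of a maximal chain. -/
theorem chainSum_eq_sum_erase {τ σ : Finset (Fin (N + 1))} (h : τ ⊂ σ) :
    chainSum T C τ σ =
      ∑ k ∈ σ \ τ, chainSum T C τ (σ.erase k) * dualLength T C (σ.erase k) σ := by
  have hcard := Finset.card_lt_card h
  obtain ⟨n, hn⟩ : ∃ n, σ.card = τ.card + n + 1 := ⟨σ.card - τ.card - 1, by omega⟩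
  have hsum : ∀ k ∈ σ \ τ, chainSum T C τ (σ.erase k) = chainSumOfLength T C n τ (σ.erase k) := by
    intro k hk
    rw [Finset.mem_sdiff] at hk
    rw [chainSum, Finset.card_erase_of_mem hk.1, show σ.card - 1 - τ.card = n by omega]
  rw [Finset.sum_congr rfl fun k hk => by rw [hsum k hk], chainSum,
    show σ.card - τ.card = n + 1 by omega, chainSumOfLength_succ]
  have hinj : Set.InjOn (fun k => σ.erase k) (σ \ τ : Finset (Fin (N + 1))) := by
    intro a ha b _ hab
    rw [Finset.mem_coe, Finset.mem_sdiff] at ha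
    by_contra hne
    have : a ∈ σ.erase b := Finset.mem_erase.2 ⟨hne, ha.1⟩
    rw [← show σ.erase a = σ.erase b from hab] at this
    exact Finset.notMem_erase _ _ this
  rw [← Finset.sum_image (g := fun k => σ.erase k)
    (f := fun ρ => chainSumOfLength T C n τ ρ * dualLength T C ρ σ) hinj]
  symm
  apply Finset.sum_subset
  · intro ρ hρ
    obtain ⟨k, hk, rfl⟩ := Finset.mem_image.1 hρ
    exact Finset.mem_ssubsets.2 (Finset.erase_ssubset (Finset.mem_sdiff.1 hk).1)
  · intro ρ hρ hρ'
    rw [Finset.mem_ssubsets] at hρ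
    -- a proper subface that a chain of length `n` reaches misses exactly one vertex of `σ`
    rw [chainSumOfLength, Finset.sum_eq_zero, zero_mul]
    intro c hc
    exfalso
    apply hρ'
    have h1 := card_add_le_of_mem_chainsOfLength hc
    have h2 := subset_of_mem_chainsOfLength hc
    have h3 := Finset.card_lt_card hρ
    obtain ⟨k, hk, hkρ⟩ := Finset.exists_of_ssubset hρ
    refine Finset.mem_image.2 ⟨k, Finset.mem_sdiff.2 ⟨hk, fun h => hkρ (h2 h)⟩, ?_⟩
    symm
    apply Finset.eq_of_subset_of_card_le
    · exact Finset.subset_erase.2 ⟨hρ.subset, hkρ⟩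
    · rw [Finset.card_erase_of_mem hk]
      omega

theorem sum_erase_eq_of_symm {ι M : Type*} [DecidableEq ι] [AddCommGroup M] [Module ℝ M]
    (s : Finset ι) (X Y : ι → ι → M)
    (h : ∀ k ∈ s, ∀ l ∈ s, k ≠ l → X k l + X l k = Y k l + Y l k) :
    ∑ k ∈ s, ∑ l ∈ s.erase k, X k l = ∑ k ∈ s, ∑ l ∈ s.erase k, Y k l := by
  have hswap : ∀ Z : ι → ι → M,
      ∑ k ∈ s, ∑ l ∈ s.erase k, Z k l = ∑ k ∈ s, ∑ l ∈ s.erase k, Z l k := by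
    intro Z
    apply Finset.sum_comm'
    intro x y
    simp only [Finset.mem_erase]
    tauto
  have h2 : (2 : ℝ) • ∑ k ∈ s, ∑ l ∈ s.erase k, X k l =
      (2 : ℝ) • ∑ k ∈ s, ∑ l ∈ s.erase k, Y k l := by
    rw [two_smul, two_smul]
    nth_rewrite 2 [hswap X]
    nth_rewrite 2 [hswap Y]
    simp only [← Finset.sum_add_distrib]
    refine Finset.sum_congr rfl fun k hk => Finset.sum_congr rfl fun l hl => ?_
    rw [Finset.mem_erase] at hl
    exact h k hk l hl.2 hl.1.symm
  exact smul_right_injective M two_ne_zero h2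

/-- The closedness of the boundary of the dual cell of `τ` in `σ`: weighting the normal of the first
step by the remaining dual lengths, or the normal of the last step by the preceding ones, gives the
same vector. Moving the normal through the chain one step at a time is `exchange_steps`. -/
theorem sum_chainSum_smul_unitNormal {τ σ : Finset (Fin (N + 1))} (hτ : τ.Nonempty) (h : τ ⊂ σ) :
    ∑ j ∈ σ \ τ, chainSum T C (insert j τ) σ • unitNormal T τ j =
      ∑ k ∈ σ \ τ, chainSum T C τ (σ.erase k) • unitNormal T (σ.erase k) k := by
  obtain ⟨n, hn⟩ : ∃ n, σ.card = τ.card + n + 1 :=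
    ⟨σ.card - τ.card - 1, by have := Finset.card_lt_card h; omega⟩
  induction n generalizing σ with
  | zero =>
    obtain ⟨j, hj, rfl⟩ := Finset.exists_eq_insert_iff.2 ⟨h.subset, hn.symm⟩
    have hs : insert j τ \ τ = {j} := by
      rw [Finset.insert_sdiff_of_notMem _ hj, sdiff_self]; rfl
    rw [hs, Finset.sum_singleton, Finset.sum_singleton, Finset.erase_insert hj, chainSum_self,
      chainSum_self]
  | succ n ih =>
    have hins : ∀ j ∈ σ \ τ, insert j τ ⊂ σ := by
      intro j hj
      rw [Finset.mem_sdiff] at hj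
      refine Finset.ssubset_iff_subset_ne.2
        ⟨Finset.insert_subset hj.1 h.subset, fun he => ?_⟩
      have := Finset.card_insert_of_notMem hj.2
      rw [he] at this
      omega
    have hera : ∀ k ∈ σ \ τ, τ ⊂ σ.erase k := by
      intro k hk
      rw [Finset.mem_sdiff] at hk
      refine Finset.ssubset_iff_subset_ne.2
        ⟨Finset.subset_erase.2 ⟨h.subset, hk.2⟩, fun he => ?_⟩
      have := Finset.card_erase_of_mem hk.1
      rw [← he] at this
      omega
    calc ∑ j ∈ σ \ τ, chainSum T C (insert j τ) σ • unitNormal T τ j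
        = ∑ j ∈ σ \ τ, ∑ k ∈ σ \ insert j τ, dualLength T C (σ.erase k) σ •
            (chainSum T C (insert j τ) (σ.erase k) • unitNormal T τ j) := by
          refine Finset.sum_congr rfl fun j hj => ?_
          rw [chainSum_eq_sum_erase T C (hins j hj), Finset.sum_smul]
          refine Finset.sum_congr rfl fun k _ => ?_
          rw [smul_smul, mul_comm]
      _ = ∑ k ∈ σ \ τ, ∑ j ∈ σ.erase k \ τ, dualLength T C (σ.erase k) σ •
            (chainSum T C (insert j τ) (σ.erase k) • unitNormal T τ j) := by
          apply Finset.sum_comm'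
          intro x y
          simp only [Finset.mem_sdiff, Finset.mem_erase, Finset.mem_insert]
          tauto
      _ = ∑ k ∈ σ \ τ, ∑ l ∈ (σ \ τ).erase k, dualLength T C (σ.erase k) σ •
            (chainSum T C τ ((σ.erase k).erase l) •
              unitNormal T ((σ.erase k).erase l) l) := by
          refine Finset.sum_congr rfl fun k hk => ?_
          rw [← Finset.smul_sum, ih (hera k hk) (by
            rw [Finset.card_erase_of_mem (Finset.mem_sdiff.1 hk).1]; omega), Finset.smul_sum,
            Finset.erase_sdiff_comm]
      _ = ∑ k ∈ σ \ τ, ∑ l ∈ (σ \ τ).erase k, (chainSum T C τ ((σ.erase k).erase l) *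
            dualLength T C ((σ.erase k).erase l) (σ.erase k)) • unitNormal T (σ.erase k) k := by
          apply sum_erase_eq_of_symm
          intro k hk l hl hkl
          rw [Finset.mem_sdiff] at hk hl
          set ρ := (σ.erase k).erase l with hρ
          have hρ' : (σ.erase l).erase k = ρ := Finset.erase_right_comm
          have hρne : ρ.Nonempty := hτ.mono (Finset.subset_erase.2
            ⟨Finset.subset_erase.2 ⟨h.subset, hk.2⟩, hl.2⟩)
          have hlρ : l ∉ ρ := Finset.notMem_erase _ _
          have hkρ : k ∉ ρ := hρ' ▸ Finset.notMem_erase _ _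
          have h1 : σ.erase k = insert l ρ :=
            (Finset.insert_erase (Finset.mem_erase.2 ⟨hkl.symm, hl.1⟩)).symm
          have h2 : σ.erase l = insert k ρ :=
            (hρ' ▸ Finset.insert_erase (Finset.mem_erase.2 ⟨hkl, hk.1⟩)).symm
          have h3 : σ = insert k (insert l ρ) := by rw [← h1, Finset.insert_erase hk.1]
          have h4 : σ = insert l (insert k ρ) := by rw [← h2, Finset.insert_erase hl.1]
          have hex := exchange_steps T C hρne hlρ hkρ hkl.symm
          rw [← h1, ← h2, Finset.insert_erase hk.1, Finset.insert_erase hl.1] at hex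
          rw [hρ', smul_comm, smul_comm _ (chainSum T C τ ρ), ← smul_add, hex, smul_add, smul_smul,
            smul_smul]
      _ = ∑ k ∈ σ \ τ, chainSum T C τ (σ.erase k) • unitNormal T (σ.erase k) k := by
          refine Finset.sum_congr rfl fun k hk => ?_
          rw [chainSum_eq_sum_erase T C (hera k hk), Finset.sum_smul, Finset.erase_sdiff_comm]

/-- Recursion on the first step of a maximal chain. -/
theorem chainSum_eq_sum_insert {τ σ : Finset (Fin (N + 1))} (hτ : τ.Nonempty) (h : τ ⊂ σ) :
    chainSum T C τ σ =
      ∑ j ∈ σ \ τ, dualLength T C τ (insert j τ) * chainSum T C (insert j τ) σ := by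
  obtain ⟨i, hi⟩ := hτ
  have hτ : τ.Nonempty := ⟨i, hi⟩
  have hF := congrArg (fun v => inner ℝ v (C - T.points i)) (sum_chainSum_smul_unitNormal T C hτ h)
  simp only [sum_inner, real_inner_smul_left] at hF
  rw [chainSum_eq_sum_erase T C h]
  convert! hF.symm using 1
  · refine Finset.sum_congr rfl fun k hk => ?_
    rw [Finset.mem_sdiff] at hk
    have hmem : i ∈ σ.erase k := Finset.mem_erase.2 ⟨fun e => hk.2 (e ▸ hi), h.subset hi⟩
    have := dualLength_insert T C ⟨i, hmem⟩ (Finset.notMem_erase k σ)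
      (points_mem_faceSpan T hmem)
    rw [Finset.insert_erase hk.1] at this
    rw [this]
  · refine Finset.sum_congr rfl fun j hj => ?_
    rw [dualLength_insert T C hτ (Finset.mem_sdiff.1 hj).2 (points_mem_faceSpan T hi), mul_comm]

end Chains

/-! ### The vertex cells of a face fill up its volume -/

section Volume

variable {N : ℕ} (T : Affine.Simplex ℝ (E N) N) (C : E N)

theorem inner_unitNormal_erase_points_sub {σ : Finset (Fin (N + 1))} {k i m : Fin (N + 1)}
    (hi : i ∈ σ.erase k) (hm : m ∈ σ) :
    inner ℝ (unitNormal T (σ.erase k) k) (T.points m - T.points i) =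
      if m = k then ‖heightVector T (σ.erase k) k‖ else 0 := by
  split_ifs with h
  · subst h
    exact inner_unitNormal_points_sub T ⟨i, hi⟩ (Finset.notMem_erase _ _)
      (points_mem_faceSpan T hi)
  · exact inner_unitNormal_of_mem T ⟨i, hi⟩
      (points_sub_mem_direction T (Finset.mem_erase.2 ⟨h, hm⟩) hi)

/-- The quotients of dual lengths by heights are the barycentric coordinates of the center, so they
sum to one. -/
theorem sum_dualLength_div_norm_heightVector {σ : Finset (Fin (N + 1))} (hσ : 2 ≤ σ.card) :
    ∑ k ∈ σ, dualLength T C (σ.erase k) σ / ‖heightVector T (σ.erase k) k‖ = 1 := by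
  have hne : σ.Nonempty := Finset.card_pos.1 (by omega)
  obtain ⟨w, hw, hC⟩ : ∃ w : Fin (N + 1) → ℝ, ∑ i ∈ σ, w i = 1 ∧
      faceCenter T C σ = ∑ i ∈ σ, w i • T.points i := by
    have h := faceCenter_mem T C hne
    obtain ⟨t, w, hts, hw, hp⟩ := eq_affineCombination_of_mem_affineSpan_image h
    rw [Finset.coe_subset] at hts
    rw [Finset.affineCombination_eq_linear_combination _ _ _ hw] at hp
    refine ⟨fun i => if i ∈ t then w i else 0, ?_, ?_⟩
    · rw [← Finset.sum_filter, Finset.filter_mem_eq_inter, Finset.inter_eq_right.2 hts, hw]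
    · simp only [ite_smul, zero_smul]
      rw [← Finset.sum_filter, Finset.filter_mem_eq_inter, Finset.inter_eq_right.2 hts, hp]
  rw [← hw]
  refine Finset.sum_congr rfl fun k hk => ?_
  have hτ : (σ.erase k).Nonempty := Finset.card_pos.1 (by
    rw [Finset.card_erase_of_mem hk]; omega)
  obtain ⟨i, hi⟩ := hτ
  have hk' := Finset.notMem_erase k σ
  have hpos := norm_heightVector_pos T ⟨i, hi⟩ hk'
  have h1 := dualLength_insert T C ⟨i, hi⟩ hk' (points_mem_faceSpan T hi)
  have h2 := inner_sub_faceCenter T C (Finset.insert_nonempty k (σ.erase k))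
    (unitNormal_mem_direction T ⟨i, hi⟩)
  rw [Finset.insert_erase hk] at h1 h2
  have h3 : faceCenter T C σ - T.points i = ∑ m ∈ σ, w m • (T.points m - T.points i) := by
    simp only [smul_sub, Finset.sum_sub_distrib, ← Finset.sum_smul, hw, one_smul, hC]
  have h4 : inner ℝ (unitNormal T (σ.erase k) k) (faceCenter T C σ - T.points i) =
      w k * ‖heightVector T (σ.erase k) k‖ := by
    rw [h3, inner_sum, Finset.sum_eq_single k]
    · rw [real_inner_smul_right, inner_unitNormal_erase_points_sub T hi hk, if_pos rfl]
    · intro m hm hmk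
      rw [real_inner_smul_right, inner_unitNormal_erase_points_sub T hi hm, if_neg hmk, mul_zero]
    · exact fun h => absurd hk h
  rw [div_eq_iff hpos.ne', ← h4, h1]
  rw [real_inner_comm] at h2
  rw [show C - T.points i = (C - faceCenter T C σ) + (faceCenter T C σ - T.points i) by abel,
    inner_add_right, h2, zero_add]

theorem heightVector_singleton (i k : Fin (N + 1)) :
    heightVector T {i} k = T.points k - T.points i := by
  rw [heightVector, faceCenter_eq_of_mem T _ (Finset.singleton_nonempty i)
    (points_mem_faceSpan T (Finset.mem_singleton_self i))]
  intro v hv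
  have : v = 0 := by simpa [faceSpan, direction_affineSpan] using hv
  rw [this, inner_zero_right]

/-- The sum over the vertices `j` of `σ` of the signed volumes of the vertex cells in `σ`, without
their common factorial. -/
def cellSum (σ : Finset (Fin (N + 1))) : ℝ :=
  ∑ j ∈ σ, chainSum T C {j} σ

theorem cellSum_singleton (i : Fin (N + 1)) : cellSum T C {i} = 1 := by
  rw [cellSum, Finset.sum_singleton, chainSum_self]

theorem cellSum_eq_sum_erase {σ : Finset (Fin (N + 1))} (hσ : 2 ≤ σ.card) :
    cellSum T C σ = ∑ k ∈ σ, dualLength T C (σ.erase k) σ * cellSum T C (σ.erase k) := by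
  calc cellSum T C σ = ∑ j ∈ σ, ∑ k ∈ σ \ {j},
        dualLength T C (σ.erase k) σ * chainSum T C {j} (σ.erase k) := by
        refine Finset.sum_congr rfl fun j hj => ?_
        rw [chainSum_eq_sum_erase T C (Finset.ssubset_iff_subset_ne.2
          ⟨Finset.singleton_subset_iff.2 hj, fun h => by simp [← h] at hσ⟩)]
        exact Finset.sum_congr rfl fun k _ => mul_comm _ _
    _ = ∑ k ∈ σ, ∑ j ∈ σ.erase k,
        dualLength T C (σ.erase k) σ * chainSum T C {j} (σ.erase k) := by
        apply Finset.sum_comm'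
        intro x y
        simp only [Finset.mem_sdiff, Finset.mem_erase, Finset.mem_singleton]
        tauto
    _ = _ := by
        simp only [cellSum, Finset.mul_sum]

/-- The cell sum obeys the recursion "base times height" of the volume, over every facet. -/
theorem cellSum_eq_norm_mul_cellSum_erase (σ : Finset (Fin (N + 1))) (hσ : 2 ≤ σ.card) :
    ∀ k ∈ σ, cellSum T C σ = ‖heightVector T (σ.erase k) k‖ * cellSum T C (σ.erase k) := by
  induction hn : σ.card using Nat.strong_induction_on generalizing σ with
  | _ n ih =>
  subst hn
  have hconst : ∀ k ∈ σ, ∀ m ∈ σ, ‖heightVector T (σ.erase k) k‖ * cellSum T C (σ.erase k) =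
      ‖heightVector T (σ.erase m) m‖ * cellSum T C (σ.erase m) := by
    intro k hk m hm
    by_cases hkm : k = m
    · rw [hkm]
    have hmk : m ∈ σ.erase k := Finset.mem_erase.2 ⟨Ne.symm hkm, hm⟩
    have hkm' : k ∈ σ.erase m := Finset.mem_erase.2 ⟨hkm, hk⟩
    have hck := Finset.card_erase_of_mem hk
    have hcm := Finset.card_erase_of_mem hm
    by_cases h2 : σ.card = 2
    · have h3 : σ.erase k = {m} := (Finset.card_eq_one.1
          (show (σ.erase k).card = 1 by omega)).elim fun a ha => by
        rw [ha] at hmk ⊢; rw [Finset.mem_singleton.1 hmk]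
      have h4 : σ.erase m = {k} := (Finset.card_eq_one.1
          (show (σ.erase m).card = 1 by omega)).elim fun a ha => by
        rw [ha] at hkm' ⊢; rw [Finset.mem_singleton.1 hkm']
      rw [h3, h4, cellSum_singleton, cellSum_singleton, heightVector_singleton,
        heightVector_singleton, norm_sub_rev]
    · set ρ := (σ.erase k).erase m with hρ
      have hρ' : (σ.erase m).erase k = ρ := Finset.erase_right_comm
      have hcρ := Finset.card_erase_of_mem hmk
      rw [← hρ] at hcρ
      have hne : ρ.Nonempty := Finset.card_pos.1 (by omega)
      have hmρ : m ∉ ρ := Finset.notMem_erase _ _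
      have hkρ : k ∉ ρ := hρ' ▸ Finset.notMem_erase _ _
      rw [ih _ (by omega) (σ.erase k) (by omega) rfl m hmk,
        ih _ (by omega) (σ.erase m) (by omega) rfl k hkm', hρ', ← hρ]
      have h := norm_heightVector_mul_comm T hne hmρ hkρ
      rw [Finset.insert_erase hmk, show insert k ρ = σ.erase m by
        rw [← hρ', Finset.insert_erase hkm']] at h
      linear_combination cellSum T C ρ * h
  intro m hm
  rw [cellSum_eq_sum_erase T C hσ]
  calc ∑ k ∈ σ, dualLength T C (σ.erase k) σ * cellSum T C (σ.erase k)
      = ∑ k ∈ σ, dualLength T C (σ.erase k) σ / ‖heightVector T (σ.erase k) k‖ *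
          (‖heightVector T (σ.erase m) m‖ * cellSum T C (σ.erase m)) := by
        refine Finset.sum_congr rfl fun k hk => ?_
        have hpos := norm_heightVector_pos T (Finset.card_pos.1 (by
          rw [Finset.card_erase_of_mem hk]; omega)) (Finset.notMem_erase k σ)
        rw [← hconst k hk m hm]
        field_simp
    _ = _ := by
        rw [← Finset.sum_mul, sum_dualLength_div_norm_heightVector T C hσ, one_mul]

theorem cellSum_insert {τ : Finset (Fin (N + 1))} {k : Fin (N + 1)} (hτ : τ.Nonempty)
    (hk : k ∉ τ) : cellSum T C (insert k τ) = ‖heightVector T τ k‖ * cellSum T C τ := by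
  have h := cellSum_eq_norm_mul_cellSum_erase T C (insert k τ)
    (by rw [Finset.card_insert_of_notMem hk]; have := Finset.card_pos.2 hτ; omega) k
    (Finset.mem_insert_self _ _)
  rwa [Finset.erase_insert hk] at h

/-- "Base times height" for Gram determinants: `h` is the component of `e i` orthogonal to the other
vectors. This is Cramer's rule for the coefficients of `h`. -/
theorem det_gram_eq_norm_sq_mul {k : ℕ} (e : Fin (k + 1) → E N) (i : Fin (k + 1))
    (x : Fin (k + 1) → ℝ) (hx : x i = 1) {h : E N} (hh : h = ∑ j, x j • e j)
    (horth : ∀ j, j ≠ i → inner ℝ (e j) h = 0) :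
    (Matrix.gram ℝ e).det =
      ‖h‖ ^ 2 * (Matrix.gram ℝ fun a => e (i.succAbove a)).det := by
  have hmul : ∀ j, (Matrix.gram ℝ e).mulVec x j = inner ℝ (e j) h := by
    intro j
    rw [hh, inner_sum]
    simp [Matrix.mulVec, dotProduct, Matrix.gram_apply, real_inner_smul_right, mul_comm]
  have hi : inner ℝ (e i) h = ‖h‖ ^ 2 := by
    rw [← real_inner_self_eq_norm_sq]
    conv_rhs => rw [hh, sum_inner, ← hh]
    rw [Finset.sum_eq_single i]
    · rw [hx, one_smul]
    · intro j _ hj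
      rw [real_inner_smul_left, horth j hj, mul_zero]
    · simp
  have hadj := congrFun (congrArg (fun M : Matrix _ _ ℝ => M.mulVec x)
    (Matrix.adjugate_mul (Matrix.gram ℝ e))) i
  simp only [← Matrix.mulVec_mulVec, Matrix.smul_mulVec, Matrix.one_mulVec, Pi.smul_apply, hx,
    smul_eq_mul, mul_one] at hadj
  rw [← hadj, Matrix.mulVec, dotProduct, Finset.sum_eq_single i]
  · rw [hmul, hi, Matrix.adjugate_fin_succ_eq_det_submatrix, ← two_mul, pow_mul]
    rw [neg_one_sq, one_pow, one_mul, mul_comm]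
    rfl
  · intro j _ hj
    rw [hmul, horth j hj, mul_zero]
  · simp

theorem sqrt_det_gram_eq_cellSum {k : ℕ} (f : Fin (k + 1) → Fin (N + 1))
    (hf : Function.Injective f) :
    √(Matrix.gram ℝ fun a : Fin k => T.points (f a.succ) - T.points (f 0)).det =
      cellSum T C (Finset.univ.image f) := by
  induction k with
  | zero =>
    rw [Matrix.det_isEmpty, Real.sqrt_one, show Finset.univ.image f = {f 0} by simp,
      cellSum_singleton]
  | succ k ih =>
    set g : Fin (k + 1) → Fin (N + 1) := fun a => f a.castSucc with hg
    have hginj : Function.Injective g := hf.comp (Fin.castSucc_injective _)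
    set τ := Finset.univ.image g with hτ
    set l := f (Fin.last (k + 1)) with hl
    have hins : Finset.univ.image f = insert l τ := by
      ext a
      simp only [hτ, hg, hl, Finset.mem_image, Finset.mem_univ, true_and, Finset.mem_insert]
      constructor
      · rintro ⟨b, rfl⟩
        induction b using Fin.lastCases with
        | last => exact Or.inl rfl
        | cast b => exact Or.inr ⟨b, rfl⟩
      · rintro (rfl | ⟨b, rfl⟩) <;> exact ⟨_, rfl⟩
    have hτne : τ.Nonempty := Finset.univ_nonempty.image g
    have hlτ : l ∉ τ := by
      rw [hτ, Finset.mem_image]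
      rintro ⟨b, -, hb⟩
      exact absurd (hf hb) (Fin.castSucc_lt_last b).ne
    have hgτ : ∀ a, g a ∈ τ := fun a => Finset.mem_image_of_mem g (Finset.mem_univ a)
    obtain ⟨c, hc⟩ : ∃ c : Fin (k + 1) → ℝ, ∑ a, c a • (T.points (g a) - T.points (g 0)) =
        faceCenter T (T.points l) τ - T.points (g 0) := by
      have hd : faceCenter T (T.points l) τ - T.points (g 0) ∈ (faceSpan T τ).direction :=
        AffineSubspace.vsub_mem_direction (faceCenter_mem T _ hτne) (points_mem_faceSpan T (hgτ 0))
      have hrange : T.points '' (τ : Set (Fin (N + 1))) = Set.range fun a => T.points (g a) := by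
        rw [hτ, Finset.coe_image, Finset.coe_univ, Set.image_univ, ← Set.range_comp]
        rfl
      rw [faceSpan, direction_affineSpan, hrange,
        vectorSpan_range_eq_span_range_vsub_right ℝ _ (0 : Fin (k + 1)),
        Submodule.mem_span_range_iff_exists_fun] at hd
      exact hd
    rw [Fin.sum_univ_succ, sub_self, smul_zero, zero_add] at hc
    set e : Fin (k + 1) → E N := fun a => T.points (f a.succ) - T.points (f 0) with he
    have hecast : ∀ a : Fin k, e a.castSucc = T.points (g a.succ) - T.points (g 0) := fun a => rfl
    have helast : e (Fin.last k) = T.points l - T.points (g 0) := rfl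
    have hsum : heightVector T τ l =
        ∑ a, (Fin.snoc (fun a => -c a.succ) 1 : Fin (k + 1) → ℝ) a • e a := by
      rw [Fin.sum_univ_castSucc, Fin.snoc_last, one_smul, helast]
      simp only [Fin.snoc_castSucc, neg_smul, Finset.sum_neg_distrib, hecast]
      rw [hc, heightVector]
      abel
    have horth : ∀ j, j ≠ Fin.last k → inner ℝ (e j) (heightVector T τ l) = 0 := by
      intro j hj
      induction j using Fin.lastCases with
      | last => exact absurd rfl hj
      | cast j =>
        rw [real_inner_comm, hecast]
        exact inner_heightVector_of_mem T hτne
          (points_sub_mem_direction T (hgτ j.succ) (hgτ 0))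
    have hdet := det_gram_eq_norm_sq_mul e (Fin.last k) _ (Fin.snoc_last _ _) hsum horth
    simp only [Fin.succAbove_last, hecast] at hdet
    rw [hdet, hins, cellSum_insert T C hτne hlτ, ← ih g hginj, Real.sqrt_mul (sq_nonneg _),
      Real.sqrt_sq (norm_nonneg _)]

theorem simplexVolume_eq_cellSum_div {k : ℕ} (s : Affine.Simplex ℝ (E N) k)
    (f : Fin (k + 1) → Fin (N + 1)) (hf : Function.Injective f)
    (hs : ∀ a, s.points a = T.points (f a)) :
    simplexVolume s = cellSum T C (Finset.univ.image f) / k ! := by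
  simp only [simplexVolume, hs]
  rw [sqrt_det_gram_eq_cellSum T C f hf]

/-- The matrix whose columns are the edge vectors at the first vertex. -/
def edgeMatrix : Matrix (Fin N) (Fin N) ℝ :=
  Matrix.of fun a j : Fin N => (T.points j.succ - T.points 0) a

theorem det_edgeMatrix : (edgeMatrix T).det = N ! * signedVolume T := by
  rw [signedVolume, mul_div_cancel₀ _ (by exact_mod_cast N.factorial_ne_zero)]
  rfl

theorem cellSum_univ : cellSum T C Finset.univ = N ! * |signedVolume T| := by
  have h := sqrt_det_gram_eq_cellSum T C id Function.injective_id
  rw [Finset.image_id] at h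
  have hg : Matrix.gram ℝ (fun a : Fin N => T.points (id a.succ) - T.points (id 0)) =
      (edgeMatrix T).transpose * edgeMatrix T := by
    ext i j
    simp [Matrix.gram_apply, Matrix.mul_apply, edgeMatrix, PiLp.inner_apply, mul_comm]
  rw [← h, hg, Matrix.det_mul, Matrix.det_transpose, Real.sqrt_mul_self_eq_abs, det_edgeMatrix,
    abs_mul, Nat.abs_cast]

theorem cellSum_pos {σ : Finset (Fin (N + 1))} (hσ : σ.Nonempty) : 0 < cellSum T C σ := by
  induction hσ using Finset.Nonempty.cons_induction with
  | singleton i => rw [cellSum_singleton]; exact one_pos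
  | cons k τ hk hτ ih =>
    rw [Finset.cons_eq_insert, cellSum_insert T C hτ hk]
    exact mul_pos (norm_heightVector_pos T hτ hk) ih

theorem signedVolume_ne_zero : signedVolume T ≠ 0 := by
  have h := cellSum_pos T 0 (σ := Finset.univ) Finset.univ_nonempty
  rw [cellSum_univ] at h
  intro h0
  simp [h0] at h

theorem simplexVolume_faceOpposite [NeZero N] (k : Fin (N + 1)) :
    simplexVolume (T.faceOpposite k) = cellSum T C (Finset.univ.erase k) / (N - 1)! := by
  have hN : N - 1 + 1 = N := Nat.sub_one_add_one (NeZero.ne N)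
  rw [simplexVolume_eq_cellSum_div T C (T.faceOpposite k)
    (fun a => k.succAbove (Fin.cast hN a))
    (fun a b hab => Fin.cast_injective _ (Fin.succAbove_right_injective hab))
    (fun a => T.faceOpposite_point_eq_point_succAbove k a)]
  congr 2
  ext a
  simp only [Finset.mem_image, Finset.mem_univ, true_and, Finset.mem_erase, and_true]
  constructor
  · rintro ⟨b, rfl⟩
    exact Fin.succAbove_ne _ _
  · intro h
    obtain ⟨b, rfl⟩ := Fin.exists_succAbove_eq h
    exact ⟨Fin.cast hN.symm b, by simp⟩

theorem erase_univ_nonempty [NeZero N] (k : Fin (N + 1)) : (Finset.univ.erase k).Nonempty := by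
  rw [← Finset.card_pos, Finset.card_erase_of_mem (Finset.mem_univ _), Finset.card_fin]
  have := NeZero.pos N
  omega

theorem simplexVolume_faceOpposite_pos [NeZero N] (k : Fin (N + 1)) :
    0 < simplexVolume (T.faceOpposite k) := by
  rw [simplexVolume_faceOpposite T 0]
  exact div_pos (cellSum_pos T 0 (erase_univ_nonempty k)) (by positivity)

theorem simplexVolume_faceOpposite_mul_norm_heightVector [NeZero N] (k : Fin (N + 1)) :
    simplexVolume (T.faceOpposite k) * ‖heightVector T (Finset.univ.erase k) k‖ =
      N * |signedVolume T| := by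
  have h := cellSum_insert T 0 (erase_univ_nonempty k) (Finset.notMem_erase k _)
  rw [Finset.insert_erase (Finset.mem_univ k), cellSum_univ] at h
  rw [simplexVolume_faceOpposite T 0, div_mul_eq_mul_div, mul_comm (cellSum _ _ _), ← h,
    div_eq_iff (by positivity), ← Nat.mul_factorial_pred (NeZero.ne N)]
  push_cast
  ring

end Volume

/-! ### Simplices with prescribed facet normals -/

section FaceNormals

variable {N : ℕ}

/-- The matrix with columns `n 1, …, n N`. -/
def columnMatrix (n : Fin (N + 1) → E N) : Matrix (Fin N) (Fin N) ℝ :=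
  Matrix.of fun a j => n j.succ a

theorem transpose_columnMatrix_mul_edgeMatrix (n : Fin (N + 1) → E N)
    (S : Affine.Simplex ℝ (E N) N) (i j : Fin N) :
    ((columnMatrix n).transpose * edgeMatrix S) i j =
      inner ℝ (n i.succ) (S.points j.succ - S.points 0) := by
  simp [columnMatrix, edgeMatrix, Matrix.mul_apply, PiLp.inner_apply, mul_comm]

variable (S : Affine.Simplex ℝ (E N) N)

/-- A vector orthogonal to the facet opposite `i` is a multiple of the unit normal there. -/
theorem exists_norm_eq_abs_and_inner_eq [NeZero N] {i : Fin (N + 1)} {w : E N}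
    (hw : ∀ j k, j ≠ i → k ≠ i → inner ℝ w (S.points j - S.points k) = 0) :
    ∃ c : ℝ, ‖w‖ = |c| ∧ ∀ j, j ≠ i →
      inner ℝ w (S.points i - S.points j) = c * ‖heightVector S (Finset.univ.erase i) i‖ := by
  have hτ := erase_univ_nonempty i
  have hi := Finset.notMem_erase i Finset.univ
  have heq := eq_smul_unitNormal S hτ hi (w := w)
    (by rw [Finset.insert_erase (Finset.mem_univ i), faceSpan_univ]; simp) (by
      have hle : (faceSpan S (Finset.univ.erase i)).direction ≤ (Submodule.span ℝ {w})ᗮ := by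
        rw [faceSpan, direction_affineSpan, vectorSpan_def, Submodule.span_le]
        rintro _ ⟨_, ⟨j, hj, rfl⟩, _, ⟨k, hk, rfl⟩, rfl⟩
        rw [Finset.mem_coe, Finset.mem_erase] at hj hk
        exact Submodule.mem_orthogonal_singleton_iff_inner_right.2 (hw j k hj.1 hk.1)
      intro v hv
      exact Submodule.mem_orthogonal_singleton_iff_inner_right.1 (hle hv))
  refine ⟨inner ℝ w (unitNormal S (Finset.univ.erase i) i), ?_, fun j hj => ?_⟩
  · conv_lhs => rw [heq]
    rw [norm_smul, norm_unitNormal S hτ hi, mul_one, Real.norm_eq_abs]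
  · conv_lhs => rw [heq]
    rw [real_inner_smul_left, inner_unitNormal_points_sub S hτ hi
      (points_mem_faceSpan S (Finset.mem_erase.2 ⟨hj, Finset.mem_univ j⟩))]

/-- Facet normals whose lengths are the facet volumes are the gradients of the barycentric
coordinates, up to the factor `-N |Vol S|`. -/
theorem areFaceNormals_iff_inner [NeZero N] (n : Fin (N + 1) → E N) :
    AreFaceNormals S n ↔
      ∀ i j, j ≠ i → inner ℝ (n i) (S.points i - S.points j) = -(N * |signedVolume S|) := by
  have hpos : ∀ i, 0 < ‖heightVector S (Finset.univ.erase i) i‖ := fun i =>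
    norm_heightVector_pos S (erase_univ_nonempty i) (Finset.notMem_erase _ _)
  constructor
  · intro h i j hj
    obtain ⟨c, hc, hin⟩ := exists_norm_eq_abs_and_inner_eq S (h.orthogonal i)
    have hout := h.outward i j hj
    rw [hin j hj] at hout ⊢
    have hneg : c < 0 := neg_of_mul_neg_left hout (hpos i).le
    rw [h.norm_eq, abs_of_neg hneg] at hc
    rw [← simplexVolume_faceOpposite_mul_norm_heightVector S i, hc]
    ring
  · intro h
    have horth : ∀ i j k, j ≠ i → k ≠ i → inner ℝ (n i) (S.points j - S.points k) = 0 := by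
      intro i j k hj hk
      rw [show S.points j - S.points k = (S.points i - S.points k) - (S.points i - S.points j) by
        abel, inner_sub_right, h i j hj, h i k hk, sub_self]
    refine ⟨horth, fun i j hj => ?_, fun i => ?_⟩
    · rw [h i j hj, neg_lt_zero]
      have := NeZero.pos N
      have := abs_pos.2 (signedVolume_ne_zero S)
      positivity
    · obtain ⟨c, hc, hin⟩ := exists_norm_eq_abs_and_inner_eq S (horth i)
      obtain ⟨j, hj⟩ := erase_univ_nonempty i
      have hji := (Finset.mem_erase.1 hj).1
      have h1 := hin j hji
      rw [h i j hji, ← simplexVolume_faceOpposite_mul_norm_heightVector S i, ← neg_mul] at h1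
      rw [hc, ← mul_right_cancel₀ (hpos i).ne' h1, abs_neg,
        abs_of_pos (simplexVolume_faceOpposite_pos S i)]

theorem areFaceNormals_iff_transpose_mul [NeZero N] (n : Fin (N + 1) → E N)
    (hn : ∑ i, n i = 0) :
    AreFaceNormals S n ↔
      (columnMatrix n).transpose * edgeMatrix S = -((N : ℝ) * |signedVolume S|) • 1 := by
  rw [areFaceNormals_iff_inner]
  constructor
  · intro h
    ext i j
    rw [transpose_columnMatrix_mul_edgeMatrix, Matrix.smul_apply, Matrix.one_apply, smul_eq_mul]
    split_ifs with hij
    · subst hij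
      rw [h _ _ (Fin.succ_ne_zero i).symm, mul_one]
    · rw [show S.points j.succ - S.points 0 =
        (S.points i.succ - S.points 0) - (S.points i.succ - S.points j.succ) by abel,
        inner_sub_right, h _ _ (Fin.succ_ne_zero i).symm,
        h _ _ (fun e => hij (Fin.succ_injective _ e).symm), sub_self, mul_zero]
  · intro h
    have hent : ∀ i j : Fin N, inner ℝ (n i.succ) (S.points j.succ - S.points 0) =
        if i = j then -((N : ℝ) * |signedVolume S|) else 0 := by
      intro i j
      rw [← transpose_columnMatrix_mul_edgeMatrix, h, Matrix.smul_apply, Matrix.one_apply,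
        smul_eq_mul, mul_ite, mul_one, mul_zero]
    intro i j hij
    induction i using Fin.cases with
    | zero =>
      induction j using Fin.cases with
      | zero => exact absurd rfl hij
      | succ j =>
        rw [Fin.sum_univ_succ] at hn
        rw [eq_neg_of_add_eq_zero_left hn, inner_neg_left, ← inner_neg_right, neg_sub, sum_inner]
        simp [hent]
    | succ i =>
      induction j using Fin.cases with
      | zero => rw [hent, if_pos rfl]
      | succ j =>
        rw [show S.points i.succ - S.points j.succ =
          (S.points i.succ - S.points 0) - (S.points j.succ - S.points 0) by abel,
          inner_sub_right, hent, hent, if_pos rfl, if_neg (fun e => hij (by rw [e])), sub_zero]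

theorem det_columnMatrix_mul [NeZero N] {n : Fin (N + 1) → E N} (hn : ∑ i, n i = 0)
    (h : AreFaceNormals S n) :
    (columnMatrix n).det * (N ! * signedVolume S) = (-1) ^ N * (N * |signedVolume S|) ^ N := by
  have := congrArg Matrix.det ((areFaceNormals_iff_transpose_mul S n hn).1 h)
  rw [Matrix.det_mul, Matrix.det_transpose, det_edgeMatrix, Matrix.det_smul, Matrix.det_one,
    Fintype.card_fin, mul_one, neg_pow] at this
  exact this

theorem AreFaceNormals.det_columnMatrix_ne_zero [NeZero N] {n : Fin (N + 1) → E N}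
    (hn : ∑ i, n i = 0) (h : AreFaceNormals S n) : (columnMatrix n).det ≠ 0 := by
  intro h0
  have hd := det_columnMatrix_mul S hn h
  rw [h0, zero_mul] at hd
  have h1 := signedVolume_ne_zero S
  have h2 : (N : ℝ) ≠ 0 := by exact_mod_cast NeZero.ne N
  have : (-1 : ℝ) ^ N * (N * |signedVolume S|) ^ N ≠ 0 := by
    have := abs_ne_zero.2 h1
    positivity
  exact this hd.symm

/-- The facet normals determine the volume of a simplex of dimension at least two. -/
theorem abs_signedVolume_pow [NeZero N] {n : Fin (N + 1) → E N} (hn : ∑ i, n i = 0)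
    (h : AreFaceNormals S n) :
    (N : ℝ) ^ N * |signedVolume S| ^ (N - 1) = N ! * |(columnMatrix n).det| := by
  have hd := congrArg abs (det_columnMatrix_mul S hn h)
  rw [abs_mul, abs_mul, abs_mul, abs_pow, abs_neg, abs_one, one_pow, one_mul, abs_pow, abs_mul,
    abs_abs, Nat.abs_cast, Nat.abs_cast, mul_pow] at hd
  have h1 := abs_ne_zero.2 (signedVolume_ne_zero S)
  have h2 : |signedVolume S| ^ N = |signedVolume S| ^ (N - 1) * |signedVolume S| := by
    rw [← pow_succ, Nat.sub_one_add_one (NeZero.ne N)]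
  apply mul_right_cancel₀ h1
  rw [mul_assoc, ← h2, ← hd]
  ring

theorem AreFaceNormals.exists_translation {n : Fin (N + 1) → E N} [NeZero N] (hN : 2 ≤ N)
    (hn : ∑ i, n i = 0) {S S' : Affine.Simplex ℝ (E N) N} (h : AreFaceNormals S n)
    (h' : AreFaceNormals S' n) : ∃ x : E N, ∀ i, S'.points i = S.points i + x := by
  have hN0 : (N : ℝ) ≠ 0 := by exact_mod_cast NeZero.ne N
  have hvol : |signedVolume S'| = |signedVolume S| := by
    have h1 := (abs_signedVolume_pow S' hn h').trans (abs_signedVolume_pow S hn h).symm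
    exact (pow_left_inj₀ (abs_nonneg _) (abs_nonneg _) (by omega)).1
      (mul_left_cancel₀ (pow_ne_zero _ hN0) h1)
  have hdet : IsUnit (columnMatrix n).transpose.det := by
    rw [Matrix.det_transpose]
    exact (h.det_columnMatrix_ne_zero S hn).isUnit
  have hedge : edgeMatrix S' = edgeMatrix S := by
    have h1 := (areFaceNormals_iff_transpose_mul S n hn).1 h
    have h2 := (areFaceNormals_iff_transpose_mul S' n hn).1 h'
    rw [hvol, ← h1] at h2
    exact (Matrix.isUnit_iff_isUnit_det _).2 hdet |>.mul_left_cancel h2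
  refine ⟨S'.points 0 - S.points 0, fun i => ?_⟩
  induction i using Fin.cases with
  | zero => abel
  | succ i =>
    have : S'.points i.succ - S'.points 0 = S.points i.succ - S.points 0 := by
      ext a
      exact congrFun (congrFun hedge a) i
    rw [eq_add_of_sub_eq this]
    abel

theorem exists_simplex_edgeMatrix_eq (M : Matrix (Fin N) (Fin N) ℝ) (hM : M.det ≠ 0) :
    ∃ S : Affine.Simplex ℝ (E N) N, edgeMatrix S = M := by
  let p : Fin (N + 1) → E N := Fin.cons 0 fun j => WithLp.toLp 2 fun a => M a j
  have hcol : LinearIndependent ℝ fun j : Fin N => (WithLp.toLp 2 (fun a => M a j) : E N) :=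
    (Matrix.linearIndependent_cols_of_det_ne_zero hM).map'
      (WithLp.linearEquiv 2 ℝ (Fin N → ℝ)).symm.toLinearMap (LinearEquiv.ker _)
  have hp : AffineIndependent ℝ p := by
    rw [affineIndependent_iff_linearIndependent_vsub ℝ _ (0 : Fin (N + 1)),
      ← linearIndependent_equiv (finSuccAboveEquiv (0 : Fin (N + 1)))]
    have hcomp : (fun x : {x : Fin (N + 1) // x ≠ 0} => p x -ᵥ p 0) ∘ finSuccAboveEquiv 0 =
        fun j : Fin N => (WithLp.toLp 2 (fun a => M a j) : E N) := by
      funext j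
      simp [p, finSuccAboveEquiv_apply]
    rw [hcomp]
    exact hcol
  refine ⟨⟨p, hp⟩, ?_⟩
  ext a j
  simp [edgeMatrix, p]

/-- Existence of a simplex with given facet normals. The dual basis of the normals gives such a
simplex up to scale, and its scale can be adjusted unless `N = 1`, where facets are points of
volume one. -/
theorem exists_areFaceNormals [NeZero N] {n : Fin (N + 1) → E N} (hn : ∑ i, n i = 0)
    (hdet : (columnMatrix n).det ≠ 0) (h1 : N = 1 → |(columnMatrix n).det| = 1) :
    ∃ S : Affine.Simplex ℝ (E N) N, AreFaceNormals S n := by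
  set d := (columnMatrix n).det with hd
  have hdpos : 0 < |d| := abs_pos.2 hdet
  obtain ⟨t, ht, htN⟩ : ∃ t : ℝ, 0 < t ∧ t ^ (N - 1) = (N - 1)! * |d| := by
    by_cases hN : N = 1
    · refine ⟨1, one_pos, ?_⟩
      rw [h1 hN, hN]
      simp
    · have hN1 : N - 1 ≠ 0 := by have := NeZero.pos N; omega
      have hpos : 0 < ((N - 1)! : ℝ) * |d| := by positivity
      exact ⟨_, Real.rpow_pos_of_pos hpos _, Real.rpow_inv_natCast_pow hpos.le hN1⟩
  have hunit : IsUnit (columnMatrix n).transpose.det := by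
    rw [Matrix.det_transpose]
    exact hdet.isUnit
  have hdetM : (-t • (columnMatrix n).transpose⁻¹).det = (-t) ^ N * d⁻¹ := by
    rw [Matrix.det_smul, Fintype.card_fin, Matrix.det_nonsing_inv, Ring.inverse_eq_inv',
      Matrix.det_transpose]
  obtain ⟨S, hS⟩ := exists_simplex_edgeMatrix_eq (-t • (columnMatrix n).transpose⁻¹) (by
    rw [hdetM]
    exact mul_ne_zero (pow_ne_zero _ (neg_ne_zero.2 ht.ne')) (inv_ne_zero hdet))
  refine ⟨S, (areFaceNormals_iff_transpose_mul S n hn).2 ?_⟩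
  rw [hS, Matrix.mul_smul, Matrix.mul_nonsing_inv _ hunit]
  congr 2
  -- the scale was chosen such that the volume of `S` is `t / N`
  have hvol : N ! * |signedVolume S| = t ^ N * |d|⁻¹ := by
    rw [← Nat.abs_cast, ← abs_mul, ← det_edgeMatrix, hS, hdetM, abs_mul, abs_pow, abs_neg,
      abs_of_pos ht, abs_inv]
  have hfac : (N ! : ℝ) = N * (N - 1)! := by
    exact_mod_cast (Nat.mul_factorial_pred (NeZero.ne N)).symm
  have htt : t ^ N = t * ((N - 1)! * |d|) := by
    rw [← htN, ← pow_succ', Nat.sub_one_add_one (NeZero.ne N)]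
  have hf : ((N - 1)! : ℝ) ≠ 0 := by positivity
  rw [hfac, htt] at hvol
  field_simp at hvol
  exact hvol.symm

end FaceNormals

/-! ### The vertex normals and the Laplacian determinant -/

section VertexNormals

variable {N : ℕ} (T : Affine.Simplex ℝ (E N) N) (C : E N)

theorem edgeWeight_comm (i j : Fin (N + 1)) : edgeWeight T C i j = edgeWeight T C j i := by
  rw [edgeWeight, edgeWeight, Finset.pair_comm, dist_comm]

theorem sum_vertexNormal : ∑ i, vertexNormal T C i = 0 := by
  have hswap : ∑ i, vertexNormal T C i = -∑ i, vertexNormal T C i := by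
    conv_lhs => simp only [vertexNormal]
    rw [Finset.sum_comm' (t' := Finset.univ) (s' := fun i => Finset.univ.erase i)
      (by intro x y; simp [eq_comm]), ← Finset.sum_neg_distrib]
    refine Finset.sum_congr rfl fun i _ => ?_
    rw [vertexNormal, ← Finset.sum_neg_distrib]
    refine Finset.sum_congr rfl fun j _ => ?_
    rw [edgeWeight_comm, ← smul_neg, neg_sub]
  have h2 : (2 : ℝ) • ∑ i, vertexNormal T C i = 0 := by
    rw [two_smul]
    exact eq_neg_iff_add_eq_zero.1 hswap
  exact (smul_eq_zero.1 h2).resolve_left two_ne_zero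

/-- The weighted Laplacian applied to the coordinate functions gives the vertex normals. -/
theorem normalMatrix_eq_mul :
    normalMatrix T C =
      edgeMatrix T * ((laplacian (edgeWeight T C)).submatrix Fin.succ Fin.succ).transpose := by
  have hL : ∀ i, vertexNormal T C i =
      ∑ j, laplacian (edgeWeight T C) i j • (T.points j - T.points 0) := by
    intro i
    have hdiag : laplacian (edgeWeight T C) i i =
        -∑ k ∈ Finset.univ.erase i, edgeWeight T C i k := by
      rw [laplacian, Matrix.of_apply, if_pos rfl]
    have hoff : ∀ j ∈ Finset.univ.erase i, laplacian (edgeWeight T C) i j •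
        (T.points j - T.points 0) = edgeWeight T C i j • (T.points j - T.points 0) := by
      intro j hj
      rw [laplacian, Matrix.of_apply, if_neg (Finset.ne_of_mem_erase hj).symm]
    rw [← Finset.add_sum_erase _ _ (Finset.mem_univ i), vertexNormal, Finset.sum_congr rfl hoff,
      hdiag, neg_smul, Finset.sum_smul, ← Finset.sum_neg_distrib, ← Finset.sum_add_distrib]
    refine Finset.sum_congr rfl fun j _ => ?_
    rw [← smul_neg, ← smul_add]
    congr 1
    abel
  ext a i
  rw [normalMatrix, Matrix.of_apply, hL, Fin.sum_univ_succ]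
  simp [Matrix.mul_apply, edgeMatrix, mul_comm]

theorem laplacianDet_eq_det_normalMatrix :
    laplacianDet T C = (-1) ^ N * (normalMatrix T C).det / (N ! * signedVolume T) := by
  have hV := signedVolume_ne_zero T
  have hf : (N ! : ℝ) ≠ 0 := by positivity
  rw [normalMatrix_eq_mul, Matrix.det_mul, Matrix.det_transpose, det_edgeMatrix, laplacianDet,
    Matrix.det_neg, Fintype.card_fin]
  field_simp

theorem laplacianDet_ne_zero_iff : laplacianDet T C ≠ 0 ↔ (normalMatrix T C).det ≠ 0 := by
  have hV := signedVolume_ne_zero T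
  have hf : (N ! : ℝ) ≠ 0 := by positivity
  rw [laplacianDet_eq_det_normalMatrix]
  simp [hV, hf]

theorem columnMatrix_vertexNormal : columnMatrix (vertexNormal T C) = normalMatrix T C := rfl

theorem edgeWeight_smul_sub {i j : Fin (N + 1)} (hij : j ≠ i) :
    edgeWeight T C i j • (T.points j - T.points i) =
      (chainSum T C (insert j {i}) Finset.univ / (N - 1)!) • unitNormal T {i} j := by
  have hcard : (Finset.univ : Finset (Fin (N + 1))).card - ({i, j} : Finset (Fin (N + 1))).card =
      N - 1 := by
    rw [Finset.card_pair hij.symm, Finset.card_fin]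
    omega
  rw [edgeWeight, dualVolume_eq_chainSum_div, hcard, unitNormal, heightVector_singleton, smul_smul,
    Finset.pair_comm i j, dist_comm, dist_eq_norm, div_eq_mul_inv _ ‖_‖]

theorem vertexNormal_eq_sum_unitNormal_singleton (i : Fin (N + 1)) :
    vertexNormal T C i = ((N - 1)! : ℝ)⁻¹ • ∑ j ∈ Finset.univ \ {i},
      chainSum T C (insert j {i}) Finset.univ • unitNormal T {i} j := by
  rw [vertexNormal, Finset.smul_sum, ← Finset.erase_eq]
  refine Finset.sum_congr rfl fun j hj => ?_
  rw [edgeWeight_smul_sub T C (Finset.ne_of_mem_erase hj), smul_smul, div_eq_inv_mul]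

theorem singleton_ssubset_univ [NeZero N] (i : Fin (N + 1)) :
    ({i} : Finset (Fin (N + 1))) ⊂ Finset.univ := by
  obtain ⟨j, hj⟩ := erase_univ_nonempty i
  refine Finset.ssubset_univ_iff.2 fun h => Finset.ne_of_mem_erase hj ?_
  exact Finset.mem_singleton.1 (h ▸ Finset.mem_univ j)

/-- The boundary of the dual cell of the vertex `i` in `T` is closed: its part inside `T` balances
its part in the facets of `T`. -/
theorem vertexNormal_eq_sum_unitNormal_erase [NeZero N] (i : Fin (N + 1)) :
    vertexNormal T C i = ((N - 1)! : ℝ)⁻¹ • ∑ k ∈ Finset.univ \ {i},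
      chainSum T C {i} (Finset.univ.erase k) • unitNormal T (Finset.univ.erase k) k := by
  rw [vertexNormal_eq_sum_unitNormal_singleton,
    sum_chainSum_smul_unitNormal T C (Finset.singleton_nonempty i) (singleton_ssubset_univ i)]

theorem vertexEdgeLength_eq_dualLength {i j : Fin (N + 1)} (hij : j ≠ i) :
    vertexEdgeLength T C i j = dualLength T C {i} (insert j {i}) := by
  have hi := points_mem_faceSpan T (Finset.mem_singleton_self i)
  have hj : j ∉ ({i} : Finset (Fin (N + 1))) := by rwa [Finset.mem_singleton]
  rw [dualLength_insert T C (Finset.singleton_nonempty i) hj hi, vertexEdgeLength, unitNormal,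
    heightVector_singleton, real_inner_smul_left, Finset.pair_comm i j, dist_comm, dist_eq_norm,
    div_eq_inv_mul]
  congr 1
  have h := inner_sub_faceCenter T C (Finset.insert_nonempty j {i})
    (points_sub_mem_direction T (Finset.mem_insert_self j {i})
      (Finset.mem_insert_of_mem (Finset.mem_singleton_self i)))
  rw [inner_sub_left] at h
  rw [real_inner_comm (C - T.points i), inner_sub_left, inner_sub_left C]
  linarith

/-- The part of a facet assigned to a vertex is the sum over the maximal chains from the vertex to
the facet. -/
theorem vertexFacetVolume_eq_chainSum_div (hN : 2 ≤ N) {k i : Fin (N + 1)} (hki : k ≠ i) :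
    vertexFacetVolume T C k i = chainSum T C {i} (Finset.univ.erase k) / (N - 1)! := by
  have hcardk : (Finset.univ.erase k).card = N := by
    rw [Finset.card_erase_of_mem (Finset.mem_univ k), Finset.card_fin, Nat.add_sub_cancel]
  have hss : {i} ⊂ Finset.univ.erase k := by
    refine Finset.ssubset_iff_subset_ne.2 ⟨Finset.singleton_subset_iff.2
      (Finset.mem_erase.2 ⟨hki.symm, Finset.mem_univ i⟩), fun h => ?_⟩
    rw [← h, Finset.card_singleton] at hcardk
    omega
  have hset : Finset.univ.filter (fun j => j ≠ k ∧ j ≠ i) = Finset.univ.erase k \ {i} := by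
    ext j
    simp
  rw [vertexFacetVolume, if_neg hki, chainSum_eq_sum_insert T C (Finset.singleton_nonempty i) hss,
    hset, Finset.sum_div, Finset.sum_div]
  refine Finset.sum_congr rfl fun j hj => ?_
  have hji : j ≠ i := by simpa using (Finset.mem_sdiff.1 hj).2
  rw [vertexEdgeLength_eq_dualLength T C hji, dualVolume_eq_chainSum_div, Finset.card_pair hji.symm,
    hcardk, Finset.pair_comm i j]
  have hf : ((N - 1)! : ℝ) = ((N : ℝ) - 1) * (N - 2)! := by
    rw [← Nat.mul_factorial_pred (show N - 1 ≠ 0 by omega), Nat.sub_sub, Nat.cast_mul,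
      Nat.cast_sub (by omega), Nat.cast_one]
  rw [hf, mul_div_assoc', div_div, mul_comm ((N - 2)! : ℝ)]

theorem vertexFacetVolume_self (k : Fin (N + 1)) : vertexFacetVolume T C k k = 0 :=
  if_pos rfl

theorem sum_vertexFacetVolume [NeZero N] (hN : 2 ≤ N) (k : Fin (N + 1)) :
    ∑ i, vertexFacetVolume T C k i = simplexVolume (T.faceOpposite k) := by
  rw [simplexVolume_faceOpposite T C, cellSum, Finset.sum_div,
    ← Finset.add_sum_erase _ _ (Finset.mem_univ k), vertexFacetVolume_self, zero_add]
  exact Finset.sum_congr rfl fun i hi =>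
    vertexFacetVolume_eq_chainSum_div T C hN (Finset.ne_of_mem_erase hi).symm

theorem vertexNormal_eq_sum_vertexFacetVolume [NeZero N] (hN : 2 ≤ N) (i : Fin (N + 1)) :
    vertexNormal T C i =
      ∑ k, vertexFacetVolume T C k i • unitNormal T (Finset.univ.erase k) k := by
  rw [vertexNormal_eq_sum_unitNormal_erase, ← Finset.erase_eq, Finset.smul_sum,
    ← Finset.add_sum_erase _ _ (Finset.mem_univ i), vertexFacetVolume_self, zero_smul, zero_add]
  refine Finset.sum_congr rfl fun k hk => ?_
  rw [vertexFacetVolume_eq_chainSum_div T C hN (Finset.ne_of_mem_erase hk), smul_smul,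
    div_eq_inv_mul]

theorem inner_unitNormal_erase_univ [NeZero N] (k j m : Fin (N + 1)) :
    inner ℝ (unitNormal T (Finset.univ.erase k) k) (T.points j - T.points m) =
      (if k = j then ‖heightVector T (Finset.univ.erase k) k‖ else 0) -
        (if k = m then ‖heightVector T (Finset.univ.erase k) k‖ else 0) := by
  obtain ⟨i, hi⟩ := erase_univ_nonempty k
  rw [show T.points j - T.points m = (T.points j - T.points i) - (T.points m - T.points i) by abel,
    inner_sub_right, inner_unitNormal_erase_points_sub T hi (Finset.mem_univ j),
    inner_unitNormal_erase_points_sub T hi (Finset.mem_univ m)]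
  simp only [eq_comm]

/-- A matrix with constant row sums: adding all columns to the first one and subtracting the first
row from the others reduces the determinant. -/
theorem det_eq_mul_det_sub_of_row_sum {n : ℕ} (M : Matrix (Fin (n + 1)) (Fin (n + 1)) ℝ) (r : ℝ)
    (hM : ∀ k, ∑ i, M k i = r) :
    M.det = r * (Matrix.of fun i j : Fin n => M i.succ j.succ - M 0 j.succ).det := by
  have h1 : (M.updateCol 0 fun _ => r).det = M.det := by
    have h := Matrix.det_updateCol_sum M 0 fun _ => 1
    simpa only [smul_eq_mul, one_mul, hM] using h
  let B : Matrix (Fin (n + 1)) (Fin (n + 1)) ℝ := Matrix.of fun i j =>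
    M.updateCol 0 (fun _ => r) i j - if i = 0 then 0 else M.updateCol 0 (fun _ => r) 0 j
  have h2 : (M.updateCol 0 fun _ => r).det = B.det := by
    refine Matrix.det_eq_of_forall_row_eq_smul_add_const (fun i => if i = 0 then 0 else 1) 0
      (if_pos rfl) fun i j => ?_
    by_cases hi : i = 0 <;> simp [B, hi]
  rw [← h1, h2, Matrix.det_succ_column_zero, Fin.sum_univ_succ, Finset.sum_eq_zero, add_zero]
  · have hsub : B.submatrix (Fin.succAbove 0) Fin.succ =
        Matrix.of fun i j : Fin n => M i.succ j.succ - M 0 j.succ := by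
      ext i j
      simp [B, Matrix.updateCol_apply]
    rw [hsub]
    simp [B]
  · intro i _
    simp [B]

theorem det_normalMatrix_mul_eq_det_vertexFacetMatrix [NeZero N] (hN : 2 ≤ N) :
    (normalMatrix T C).det * (N ! * signedVolume T) *
        ∏ i, simplexVolume (T.faceOpposite i) =
      (N * |signedVolume T|) ^ N * (vertexFacetMatrix T C).det := by
  set h : Fin (N + 1) → ℝ := fun k => ‖heightVector T (Finset.univ.erase k) k‖ with hh
  set r : ℝ := N * |signedVolume T| with hr
  have hAh : ∀ k, simplexVolume (T.faceOpposite k) * h k = r :=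
    simplexVolume_faceOpposite_mul_norm_heightVector T
  have hr0 : r ≠ 0 := by
    have := abs_ne_zero.2 (signedVolume_ne_zero T)
    have := NeZero.ne N
    positivity
  have hrow := det_eq_mul_det_sub_of_row_sum
    (Matrix.of fun k i => h k * vertexFacetMatrix T C k i) r (fun k => by
      simp only [Matrix.of_apply, vertexFacetMatrix]
      rw [← Finset.mul_sum, sum_vertexFacetVolume T C hN, mul_comm, hAh])
  have hscale : (Matrix.of fun k i => h k * vertexFacetMatrix T C k i).det =
      (∏ k, h k) * (vertexFacetMatrix T C).det := Matrix.det_mul_column _ _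
  have hdiff : (Matrix.of fun i j : Fin N =>
      (Matrix.of fun k i => h k * vertexFacetMatrix T C k i) i.succ j.succ -
        (Matrix.of fun k i => h k * vertexFacetMatrix T C k i) 0 j.succ) =
      ((columnMatrix (vertexNormal T C)).transpose * edgeMatrix T).transpose := by
    ext j i
    rw [Matrix.transpose_apply, transpose_columnMatrix_mul_edgeMatrix,
      vertexNormal_eq_sum_vertexFacetVolume T C hN, sum_inner]
    simp only [real_inner_smul_left, inner_unitNormal_erase_univ, mul_sub, mul_ite, mul_zero,
      Finset.sum_sub_distrib, Finset.sum_ite_eq', Finset.mem_univ, if_true, Matrix.of_apply,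
      vertexFacetMatrix, hh]
    ring
  rw [hdiff, hscale, Matrix.det_transpose, Matrix.det_mul, Matrix.det_transpose, det_edgeMatrix,
    columnMatrix_vertexNormal] at hrow
  have hprod : (∏ i, simplexVolume (T.faceOpposite i)) * ∏ k, h k = r ^ (N + 1) := by
    rw [← Finset.prod_mul_distrib, Finset.prod_congr rfl fun k _ => hAh k, Finset.prod_const,
      Finset.card_fin]
  apply mul_left_cancel₀ hr0
  rw [← mul_assoc r (r ^ N), ← pow_succ', ← hprod]
  linear_combination (-∏ i, simplexVolume (T.faceOpposite i)) * hrow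

/-- In dimension one the facets are points, and the vertex normals are unit vectors. -/
theorem abs_det_normalMatrix_of_eq_one (hN : N = 1) : |(normalMatrix T C).det| = 1 := by
  subst hN
  have h10 : (0 : Fin 2) ∉ ({1} : Finset (Fin 2)) := by decide
  have hn : vertexNormal T C 1 = unitNormal T {1} 0 := by
    rw [vertexNormal_eq_sum_unitNormal_singleton,
      show (Finset.univ \ {1} : Finset (Fin (1 + 1))) = {0} by decide, Finset.sum_singleton,
      show (insert 0 {1} : Finset (Fin (1 + 1))) = Finset.univ by decide, chainSum_self]
    simp
  have hnorm := norm_unitNormal T (Finset.singleton_nonempty 1) h10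
  rw [← hn, EuclideanSpace.norm_eq] at hnorm
  rw [Matrix.det_fin_one]
  change |vertexNormal T C 1 0| = 1
  simpa [Real.sqrt_sq_eq_abs] using hnorm

end VertexNormals

/-! ### The formulas for the Laplacian determinant -/

section Formulas

variable {N : ℕ} [NeZero N] (T : Affine.Simplex ℝ (E N) N) (C : E N)

theorem exists_areFaceNormals_vertexNormal_iff :
    (∃ S : Affine.Simplex ℝ (E N) N, AreFaceNormals S (vertexNormal T C)) ↔
      laplacianDet T C ≠ 0 := by
  rw [laplacianDet_ne_zero_iff]
  exact ⟨fun ⟨S, hS⟩ => hS.det_columnMatrix_ne_zero S (sum_vertexNormal T C), fun h =>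
    exists_areFaceNormals (sum_vertexNormal T C) h (abs_det_normalMatrix_of_eq_one T C)⟩

theorem laplacianDet_eq_of_areFaceNormals {S : Affine.Simplex ℝ (E N) N}
    (hS : AreFaceNormals S (vertexNormal T C)) :
    laplacianDet T C = (N : ℝ) ^ N *
      ((SignType.sign (signedVolume S) : ℝ) * |signedVolume S| ^ (N - 1)) /
        ((N ! : ℝ) ^ 2 * signedVolume T) := by
  have hd := det_columnMatrix_mul S (sum_vertexNormal T C) hS
  rw [columnMatrix_vertexNormal] at hd
  have hT := signedVolume_ne_zero T
  have hS0 := signedVolume_ne_zero S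
  have hf : (N ! : ℝ) ≠ 0 := by positivity
  have hpow : |signedVolume S| ^ N =
      SignType.sign (signedVolume S) * |signedVolume S| ^ (N - 1) * signedVolume S := by
    rw [mul_right_comm, sign_mul_self, ← pow_succ', Nat.sub_one_add_one (NeZero.ne N)]
  have hdet : (normalMatrix T C).det * N ! = (-1) ^ N * N ^ N *
      (SignType.sign (signedVolume S) * |signedVolume S| ^ (N - 1)) := by
    apply mul_right_cancel₀ hS0
    rw [mul_pow, hpow] at hd
    linear_combination hd
  have hsq : ((-1 : ℝ) ^ N) * (-1) ^ N = 1 := by rw [← mul_pow]; simp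
  rw [laplacianDet_eq_det_normalMatrix, div_eq_div_iff (by positivity) (by positivity)]
  linear_combination ((-1) ^ N * N ! * signedVolume T) * hdet +
    N ^ N * (SignType.sign (signedVolume S) * |signedVolume S| ^ (N - 1)) * N ! * signedVolume T *
      hsq

theorem sign_mul_abs_pow_pred {n : ℕ} (hn : n ≠ 0) {v : ℝ} (hv : Even n ∨ 0 < v) :
    (SignType.sign v : ℝ) * |v| ^ (n - 1) = v ^ (n - 1) := by
  rcases lt_trichotomy v 0 with h | h | h
  · have hodd : Odd (n - 1) :=
      Nat.Even.sub_odd (by omega) (hv.resolve_right h.not_gt) odd_one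
    rw [sign_neg h, abs_of_neg h, hodd.neg_pow]
    simp
  · subst h
    have : n - 1 ≠ 0 := by
      have := (hv.resolve_right (lt_irrefl _))
      intro h0
      rw [show n = 1 by omega] at this
      exact absurd this (by decide)
    simp [this]
  · rw [sign_pos h, abs_of_pos h]
    simp

theorem laplacianDet_eq_det_vertexFacetMatrix (hN : 2 ≤ N) :
    laplacianDet T C = (-1) ^ N * (N : ℝ) ^ N * |signedVolume T| ^ (N - 2) *
      (vertexFacetMatrix T C).det /
        ((N ! : ℝ) ^ 2 * ∏ i, simplexVolume (T.faceOpposite i)) := by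
  have h := det_normalMatrix_mul_eq_det_vertexFacetMatrix T C hN
  have hT := signedVolume_ne_zero T
  have hf : (N ! : ℝ) ≠ 0 := by positivity
  have hP : ∏ i, simplexVolume (T.faceOpposite i) ≠ 0 :=
    Finset.prod_ne_zero_iff.2 fun i _ => (simplexVolume_faceOpposite_pos T i).ne'
  have hpow : |signedVolume T| ^ N = |signedVolume T| ^ (N - 2) * signedVolume T ^ 2 := by
    rw [← sq_abs, ← pow_add, Nat.sub_add_cancel hN]
  rw [mul_pow, hpow] at h
  rw [laplacianDet_eq_det_normalMatrix, div_eq_div_iff (mul_ne_zero hf hT)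
    (mul_ne_zero (pow_ne_zero _ hf) hP)]
  apply mul_right_cancel₀ hT
  linear_combination ((-1) ^ N * N !) * h

end Formulas

end

end SimplexDuality

theorem mainTheorem1 {N : ℕ} [NeZero N]
    (T : Affine.Simplex ℝ (EuclideanSpace ℝ (Fin N)) N) (C : EuclideanSpace ℝ (Fin N)) :
    -- the formula through the normal matrix
    SimplexDuality.laplacianDet T C =
      (-1) ^ N * (SimplexDuality.normalMatrix T C).det / (N ! * SimplexDuality.signedVolume T) ∧
    -- the dual simplex exists unless the Laplacian determinant vanishes
    ((∃ S : Affine.Simplex ℝ (EuclideanSpace ℝ (Fin N)) N,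
        SimplexDuality.AreFaceNormals S (SimplexDuality.vertexNormal T C)) ↔
      SimplexDuality.laplacianDet T C ≠ 0) ∧
    -- the dual simplex is unique up to translation
    (2 ≤ N → ∀ S S' : Affine.Simplex ℝ (EuclideanSpace ℝ (Fin N)) N,
      SimplexDuality.AreFaceNormals S (SimplexDuality.vertexNormal T C) →
      SimplexDuality.AreFaceNormals S' (SimplexDuality.vertexNormal T C) →
      ∃ x : EuclideanSpace ℝ (Fin N), ∀ i, S'.points i = S.points i + x) ∧
    -- the formula through the volume of the dual simplex
    (∀ S : Affine.Simplex ℝ (EuclideanSpace ℝ (Fin N)) N,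
      SimplexDuality.AreFaceNormals S (SimplexDuality.vertexNormal T C) →
      SimplexDuality.laplacianDet T C =
        (N : ℝ) ^ N *
            ((SignType.sign (SimplexDuality.signedVolume S) : ℝ) *
              |SimplexDuality.signedVolume S| ^ (N - 1)) /
          ((N ! : ℝ) ^ 2 * SimplexDuality.signedVolume T) ∧
      (Even N ∨ 0 < SimplexDuality.signedVolume S →
        SimplexDuality.laplacianDet T C =
          (N : ℝ) ^ N * SimplexDuality.signedVolume S ^ (N - 1) /
            ((N ! : ℝ) ^ 2 * SimplexDuality.signedVolume T))) ∧
    -- the formula through the parts of the facets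
    (2 ≤ N →
      SimplexDuality.laplacianDet T C =
        (-1) ^ N * (N : ℝ) ^ N * |SimplexDuality.signedVolume T| ^ (N - 2) *
            (SimplexDuality.vertexFacetMatrix T C).det /
          ((N ! : ℝ) ^ 2 * ∏ i, SimplexDuality.simplexVolume (T.faceOpposite i))) := by
  refine ⟨SimplexDuality.laplacianDet_eq_det_normalMatrix T C,
    SimplexDuality.exists_areFaceNormals_vertexNormal_iff T C,
    fun hN S S' hS hS' => hS.exists_translation hN (SimplexDuality.sum_vertexNormal T C) hS',
    fun S hS => ⟨SimplexDuality.laplacianDet_eq_of_areFaceNormals T C hS, fun h => ?_⟩,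
    SimplexDuality.laplacianDet_eq_det_vertexFacetMatrix T C⟩
  rw [SimplexDuality.laplacianDet_eq_of_areFaceNormals T C hS,
    SimplexDuality.sign_mul_abs_pow_pred (NeZero.ne N) h]
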